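/- Let $K$ be a compact Lie group with Lie algebra $\mathfrak k$, and let $G=K^{\mathbb C}$ be its complexification: a complex Lie group with finitely many connected components that contains $K$ as a maximal compact subgroup and has Lie algebra $\mathfrak g=\mathfrak k\oplus i\mathfrak k$. Let $Q$ be a connected (Hausdorff) complex manifold with a transitive holomorphic right action of $G$, let $q_0\in Q$ be a point whose stabiliser $\Gamma\subset G$ is discrete, and suppose that $K\subset G$ acts freely on $Q$. *The main construction.* Let $P$ be a smooth manifold with a smooth free right action of $K$, i.e. a principal $K$-bundle $P\to P/K$. Let $X^\#$ denote the fundamental vector field of $X\in\mathfrak k$. Let $\omega_A$ be the connection form of a connection $A\subset TP$ (so $A=\ker\omega_A$), and let $\alpha$ be a smooth $\mathfrak k$-valued one-form on $P$ that vanishes on vertical vectors, satisfies $R_k^*\alpha=\mathrm{ad}_{k^{-1}}\alpha$ for $k\in K$, and restricts to an isomorphism $\alpha_p|_{A_p}:A_p\to\mathfrak k$ for each $p\in P$. The associated almost complex structure $J_\alpha$ on $P$ is given by $$J_\alpha(w+X^\#_p)=\bigl(\alpha_p(w)\bigr)^\#_p-(\alpha_p|_{A_p})^{-1}(X),\qquad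 w\in A_p,\ X\in\mathfrak k .$$ *The sample situation.* For $Z\in\mathfrak g$ let $Z^\#$ denote the left-invariant vector field on $G$ with value $Z$ at the identity. On the $K$-bundle $G\to G/K$ there are a unique connection form $\omega_A$ and a unique tensorial form $\alpha$ as above such that, for all $X,Y\in\mathfrak k$, $$\omega_A\bigl((X+iY)^\#\bigr)=X,\qquad \alpha\bigl((X+iY)^\#\bigr)=-Y .$$ **Proposition 4.1.** The orbit map $\psi:G\to Q$, $g\mapsto q_0g$, is a surjective local biholomorphism, so that $Q\cong\Gamma\backslash G$. On the $K$-bundle $Q\to Q/K$ there are a unique connection form $\omega_{\bar A}$ and a unique tensorial form $\bar\alpha$, as in the main construction, such that $\psi^*\omega_{\bar A}=\omega_A$ and $\psi^*\bar\alpha=\alpha$. The almost complex structure $J_{\bar\alpha}$ that they define on $Q$ equals the canonical (almost) complex structure of $Q$. -/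

import Mathlib

open scoped Manifold ContDiff RightActions

noncomputable section

/-! ### The real manifold underlying a complex manifold -/

/-- A complex manifold, with the same charts, is a real analytic manifold. -/
instance realIsManifold {E : Type*} [NormedAddCommGroup E] [NormedSpace ℂ E]
    {M : Type*} [TopologicalSpace M] [ChartedSpace E M] [IsManifold 𝓘(ℂ, E) ω M] :
    IsManifold 𝓘(ℝ, E) ω M := by
  refine isManifold_of_contDiffOn 𝓘(ℝ, E) ω M fun e e' he he' => ?_
  have h := (contDiffGroupoid ω 𝓘(ℂ, E)).compatible he he'
  rw [contDiffGroupoid, mem_groupoid_of_pregroupoid] at h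
  exact ContDiffOn.restrict_scalars ℝ h.1

/-- The canonical almost complex structure of a complex manifold: multiplication by the imaginary
unit on each tangent space. (The tangent space of the underlying real manifold and the complex
tangent space at `q` are both the model space `E`, through the preferred chart at `q`.) -/
def canonicalJ (E : Type*) [NormedAddCommGroup E] [NormedSpace ℂ E]
    (M : Type*) [TopologicalSpace M] [ChartedSpace E M] (q : M) :
    TangentSpace 𝓘(ℝ, E) q →ₗ[ℝ] TangentSpace 𝓘(ℝ, E) q :=
  show E →ₗ[ℝ] E from
    { toFun := fun v => Complex.I • v
      map_add' := fun v w => smul_add _ v w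
      map_smul' := fun c v => smul_comm _ c v }

/-! ### Almost complex structures on principal bundles with compact structure group -/

section Principal

variable {F : Type*} [NormedAddCommGroup F] [NormedSpace ℝ F]
  {K : Type*} [TopologicalSpace K] [ChartedSpace F K] [Group K]
  {E : Type*} [NormedAddCommGroup E] [NormedSpace ℝ E]
  {P : Type*} [TopologicalSpace P] [ChartedSpace E P]

/-- The adjoint action of `k` on the Lie algebra of `K`: the derivative at `1` of `h ↦ k h k⁻¹`. -/
def adjoint (k : K) : GroupLieAlgebra 𝓘(ℝ, F) K →L[ℝ] GroupLieAlgebra 𝓘(ℝ, F) K :=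
  show F →L[ℝ] F from mfderiv 𝓘(ℝ, F) 𝓘(ℝ, F) (fun h : K => k * h * k⁻¹) 1

/-- The value at `p` of the fundamental vector field `X^#` of a right action `ρ` of `K` on `P`: the
derivative at `1` of `k ↦ p k`, applied to `X`. -/
def fundamental (ρ : P → K → P) (p : P) :
    GroupLieAlgebra 𝓘(ℝ, F) K →L[ℝ] TangentSpace 𝓘(ℝ, E) p :=
  show F →L[ℝ] E from mfderiv 𝓘(ℝ, F) 𝓘(ℝ, E) (fun k : K => ρ p k) 1

/-- `ρ` is a smooth free right action of the compact Lie group `K` on the manifold `P`; equivalently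
(as `K` is compact), `P → P / K` is a principal `K`-bundle with this right action. -/
structure IsPrincipalAction [CompactSpace K] (ρ : P → K → P) : Prop where
  act_one : ∀ p, ρ p 1 = p
  act_mul : ∀ p k l, ρ p (k * l) = ρ (ρ p k) l
  free : ∀ p k, ρ p k = p → k = 1
  smooth : ContMDiff (𝓘(ℝ, E).prod 𝓘(ℝ, F)) 𝓘(ℝ, E) ∞ (fun x : P × K => ρ x.1 x.2)

/-- A smooth one-form on `P` with values in the Lie algebra `𝔨` of `K` which is of type ad:
`R_k^* β = ad_{k⁻¹} ∘ β`. Smoothness is stated as smoothness of `β : TP → 𝔨`. -/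
structure IsAdForm [IsManifold 𝓘(ℝ, E) ∞ P] (ρ : P → K → P)
    (β : ∀ p : P, TangentSpace 𝓘(ℝ, E) p →L[ℝ] GroupLieAlgebra 𝓘(ℝ, F) K) : Prop where
  smooth : ContMDiff 𝓘(ℝ, E).tangent 𝓘(ℝ, F) ∞
    (fun v : TangentBundle 𝓘(ℝ, E) P => (show F from β v.proj v.snd))
  equivariant : ∀ (p : P) (k : K) (v : TangentSpace 𝓘(ℝ, E) p),
    β (ρ p k) (mfderiv 𝓘(ℝ, E) 𝓘(ℝ, E) (fun x : P => ρ x k) p v) = adjoint k⁻¹ (β p v)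

variable [CompactSpace K] [IsManifold 𝓘(ℝ, E) ∞ P]

/-- The data of the main construction: a principal action of `K` on `P`, a connection, given by its
connection form `conn` (whose kernel is the horizontal subbundle), and a tensorial `𝔨`-valued
one-form `form` of type ad that is an isomorphism from each horizontal space onto `𝔨`. -/
structure MainData (ρ : P → K → P) where
  principal : IsPrincipalAction (F := F) (E := E) ρ
  conn : ∀ p : P, TangentSpace 𝓘(ℝ, E) p →L[ℝ] GroupLieAlgebra 𝓘(ℝ, F) K
  conn_ad : IsAdForm ρ conn
  conn_fundamental : ∀ (p : P) (X : GroupLieAlgebra 𝓘(ℝ, F) K), conn p (fundamental ρ p X) = X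
  form : ∀ p : P, TangentSpace 𝓘(ℝ, E) p →L[ℝ] GroupLieAlgebra 𝓘(ℝ, F) K
  form_ad : IsAdForm ρ form
  form_fundamental : ∀ (p : P) (X : GroupLieAlgebra 𝓘(ℝ, F) K), form p (fundamental ρ p X) = 0
  form_bijective : ∀ p : P, Function.Bijective
    ((form p).toLinearMap.domRestrict (conn p).toLinearMap.ker)

namespace MainData

variable {ρ : P → K → P} (D : MainData (F := F) (E := E) ρ)

/-- The horizontal subspace at `p`. -/
def horizontal (p : P) : Submodule ℝ (TangentSpace 𝓘(ℝ, E) p) := (D.conn p).toLinearMap.ker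

/-- The isomorphism from the horizontal space at `p` onto `𝔨` given by the tensorial form. -/
def formEquiv (p : P) : D.horizontal p ≃ₗ[ℝ] GroupLieAlgebra 𝓘(ℝ, F) K :=
  LinearEquiv.ofBijective ((D.form p).toLinearMap.domRestrict (D.horizontal p))
    (D.form_bijective p)

/-- The almost complex structure `J_α` of the main construction. On `w + X^#` with `w` horizontal it
is `α(w)^# - α⁻¹(X)`, where `α⁻¹` takes values in the horizontal space; here `X` is the value of the
connection form, and `α(w) = α(w + X^#)`. -/
def J (p : P) : TangentSpace 𝓘(ℝ, E) p →ₗ[ℝ] TangentSpace 𝓘(ℝ, E) p :=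
  (fundamental ρ p).toLinearMap ∘ₗ (D.form p).toLinearMap
    - (D.horizontal p).subtype ∘ₗ (D.formEquiv p).symm.toLinearMap ∘ₗ (D.conn p).toLinearMap

end MainData

end Principal

/-! ### The complexification of a compact Lie group and the sample form -/

section Complexification

variable {F : Type*} [NormedAddCommGroup F] [NormedSpace ℝ F]
  {K : Type*} [TopologicalSpace K] [ChartedSpace F K] [Group K]
  {E : Type*} [NormedAddCommGroup E] [NormedSpace ℂ E]
  {G : Type*} [TopologicalSpace G] [ChartedSpace E G] [Group G]

/-- The derivative at `1` of `ι : K → G`, as a map `𝔨 → 𝔤` of Lie algebras. -/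
def lieMap (ι : K →* G) : GroupLieAlgebra 𝓘(ℝ, F) K →L[ℝ] GroupLieAlgebra 𝓘(ℝ, E) G :=
  show F →L[ℝ] E from mfderiv 𝓘(ℝ, F) 𝓘(ℝ, E) ι 1

/-- The element `X + i Y` of the Lie algebra `𝔤` of `G`, for `X`, `Y` in the Lie algebra `𝔨` of `K`,
which is mapped to `𝔤` by the derivative of `ι : K → G`. -/
def complexElement (ι : K →* G) (X Y : GroupLieAlgebra 𝓘(ℝ, F) K) : GroupLieAlgebra 𝓘(ℝ, E) G :=
  lieMap ι X + canonicalJ E G 1 (lieMap ι Y)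

/-- The complex Lie group `G` is, through `ι`, the complexification of the compact Lie group `K`:
`G` has finitely many connected components, `ι` embeds `K` as a maximal compact subgroup of `G`, and
the Lie algebra of `G` is `𝔨 ⊕ i 𝔨`. -/
structure IsComplexification [CompactSpace K] (ι : K →* G) : Prop where
  smooth : ContMDiff 𝓘(ℝ, F) 𝓘(ℝ, E) ∞ ι
  injective : Function.Injective ι
  maximal : ∀ L : Subgroup G, IsCompact (L : Set G) → ι.range ≤ L → L = ι.range
  finite_components : Finite (ConnectedComponents G)
  lieAlgebra : Function.Bijective
    (fun Z : GroupLieAlgebra 𝓘(ℝ, F) K × GroupLieAlgebra 𝓘(ℝ, F) K =>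
      (complexElement ι Z.1 Z.2 : GroupLieAlgebra 𝓘(ℝ, E) G))

/-- The right action of `K` on `G` by right translations through `ι`. -/
def translationAction (ι : K →* G) : G → K → G := fun g k => g * ι k

/-- The restriction to `K`, through `ι`, of a right action of `G` on `Q`. -/
def restrictedAction {Q : Type*} [MulAction Gᵐᵒᵖ Q] (ι : K →* G) : Q → K → Q :=
  fun q k => q <• ι k

variable [CompactSpace K] [IsManifold 𝓘(ℂ, E) ω G]

/-- The sample data on the `K`-bundle `G → G / K`: on left-invariant vector fields the tensorial form
is `α((X + iY)^#) = -Y`, and the connection form is `(X + iY)^# ↦ X`, i.e. the horizontal spaces are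
the left translates of `i 𝔨`. -/
def IsSample (ι : K →* G)
    (S : MainData (F := F) (E := E) (translationAction (K := K) (G := G) ι)) : Prop :=
  ∀ (g : G) (X Y : GroupLieAlgebra 𝓘(ℝ, F) K),
    S.form g (mulInvariantVectorField (complexElement ι X Y) g) = -Y ∧
    S.conn g (mulInvariantVectorField (complexElement ι X Y) g) = X

/-- The data `D` on `Q` descend from the data `S` on `G` along the orbit map `g ↦ q₀ g`: the form and
the connection form of `S` are the pull-backs of those of `D`. -/
def DescendsTo {E' : Type*} [NormedAddCommGroup E'] [NormedSpace ℂ E']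
    {Q : Type*} [TopologicalSpace Q] [ChartedSpace E' Q] [IsManifold 𝓘(ℂ, E') ω Q]
    [MulAction Gᵐᵒᵖ Q] (ι : K →* G) (q₀ : Q)
    (S : MainData (F := F) (E := E) (translationAction (K := K) (G := G) ι))
    (D : MainData (F := F) (E := E') (restrictedAction (K := K) (G := G) (Q := Q) ι)) : Prop :=
  ∀ (g : G) (v : TangentSpace 𝓘(ℝ, E) g),
    D.form (q₀ <• g) (mfderiv 𝓘(ℝ, E) 𝓘(ℝ, E') (fun h : G => q₀ <• h) g v) = S.form g v ∧
    D.conn (q₀ <• g) (mfderiv 𝓘(ℝ, E) 𝓘(ℝ, E') (fun h : G => q₀ <• h) g v) = S.conn g v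

end Complexification

end

/-! Everything is carried by the left Maurer–Cartan form `θ` of `G`, viewed as a coframe with values
in `𝔤 = 𝔨 ⊕ i𝔨`. Writing `θ = X + iY`, the sample connection form is `X` and the sample tensorial
form is `-Y` (`isSample_iff`). Since `Ad` of `K` preserves `𝔨` and is complex linear, the two
components are separately of type ad. For any such coframe the almost complex structure of the main
construction satisfies `θ ∘ J = i θ` (`MainData.coframe_J`): its two terms contribute `-Y` and `iX`,
and `-Y + iX = i(X + iY)`.

As `θ` is invariant under left translations, it descends along the orbit map `ψ` to a coframe on `Q`
(`exists_descended_maurerCartan`), whose components are the only data pulling back to the sample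
(`descendsTo_iff`). Left translations and `ψ` are holomorphic, so the descended coframe also
intertwines the canonical structure of `Q` with multiplication by `i`. Being injective at each
point, it forces the two structures to agree.

That `ψ` is a local biholomorphism has two halves. A kernel vector of `dψ` at `1` extends to an
invariant field killed by `dψ`; its integral curve through `1` stays in the discrete stabiliser, so
it is constant and the vector vanishes. Conversely, finitely many components make `G` `σ`-compact,
hence `ψ` is open by a Baire argument, and an open `C¹` map does not raise dimension. The dimensions
therefore agree, `dψ` is bijective, and the inverse function theorem applies. -/

/-! ### Complex and real smoothness and derivatives. -/

section RestrictScalars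

variable {E : Type*} [NormedAddCommGroup E] [NormedSpace ℂ E] [NormedSpace ℝ E]
  [IsScalarTower ℝ ℂ E] {H : Type*} [TopologicalSpace H]
  {E' : Type*} [NormedAddCommGroup E'] [NormedSpace ℂ E'] [NormedSpace ℝ E']
  [IsScalarTower ℝ ℂ E'] {H' : Type*} [TopologicalSpace H']
  {I : ModelWithCorners ℂ E H} {J : ModelWithCorners ℝ E H}
  {I' : ModelWithCorners ℂ E' H'} {J' : ModelWithCorners ℝ E' H'}
  {M : Type*} [TopologicalSpace M] [ChartedSpace H M]
  {N : Type*} [TopologicalSpace N] [ChartedSpace H' N]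
  {f : M → N} {x : M} {n : ℕ∞ω}

omit [IsScalarTower ℝ ℂ E] in
theorem extChartAt_eq_of_toPartialEquiv_eq (h : I.toPartialEquiv = J.toPartialEquiv) (x : M) :
    extChartAt I x = extChartAt J x := by
  simp only [extChartAt, OpenPartialHomeomorph.extend, h]

omit [IsScalarTower ℝ ℂ E] in
theorem range_eq_of_toPartialEquiv_eq (h : I.toPartialEquiv = J.toPartialEquiv) :
    Set.range I = Set.range J := by
  have : (I : H → E) = J := congrArg (fun e : PartialEquiv H E => (e : H → E)) h
  rw [this]

/-- Comparing models through their underlying partial equivalences covers products such as `𝓘(ℂ,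
E').prod 𝓘(ℂ, E)` as well as `𝓘(ℂ, E)`; in each use both hypotheses are `rfl`. -/
theorem ContMDiffAt.restrictScalars_real (h : I.toPartialEquiv = J.toPartialEquiv)
    (h' : I'.toPartialEquiv = J'.toPartialEquiv) (hf : ContMDiffAt I I' n f x) :
    ContMDiffAt J J' n f x := by
  rw [contMDiffAt_iff] at hf ⊢
  rw [← extChartAt_eq_of_toPartialEquiv_eq h, ← extChartAt_eq_of_toPartialEquiv_eq h',
    ← range_eq_of_toPartialEquiv_eq h]
  exact ⟨hf.1, hf.2.restrict_scalars ℝ⟩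

theorem ContMDiff.restrictScalars_real (h : I.toPartialEquiv = J.toPartialEquiv)
    (h' : I'.toPartialEquiv = J'.toPartialEquiv) (hf : ContMDiff I I' n f) :
    ContMDiff J J' n f :=
  fun x => (hf x).restrictScalars_real h h'

end RestrictScalars

section RealDerivative

variable {E : Type*} [NormedAddCommGroup E] [NormedSpace ℝ E]
  {M : Type*} [TopologicalSpace M] [ChartedSpace E M]
  {E' : Type*} [NormedAddCommGroup E'] [NormedSpace ℝ E']
  {M' : Type*} [TopologicalSpace M'] [ChartedSpace E' M']
  {E'' : Type*} [NormedAddCommGroup E''] [NormedSpace ℝ E'']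
  {M'' : Type*} [TopologicalSpace M''] [ChartedSpace E'' M'']

variable (E E') in
/-- The derivative of a map of real manifolds, as a map of the model spaces. -/
noncomputable def modelDeriv (f : M → M') (x : M) : E →L[ℝ] E' :=
  mfderiv 𝓘(ℝ, E) 𝓘(ℝ, E') f x

/-- With values in fixed model spaces, base points such as `g * 1` can be rewritten without
transporting tangent vectors. -/
theorem modelDeriv_comp {g : M' → M''} {f : M → M'} (x : M)
    (hg : MDifferentiableAt 𝓘(ℝ, E') 𝓘(ℝ, E'') g (f x))
    (hf : MDifferentiableAt 𝓘(ℝ, E) 𝓘(ℝ, E') f x) (v : E) :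
    modelDeriv E E'' (fun y => g (f y)) x v
      = modelDeriv E' E'' g (f x) (modelDeriv E E' f x v) :=
  congrArg (fun T : E →L[ℝ] E'' => T v) (mfderiv_comp x hg hf)

theorem modelDeriv_id (x : M) (v : E) : modelDeriv E E (fun y : M => y) x v = v :=
  congrArg (fun T : E →L[ℝ] E => T v) (mfderiv_id (I := 𝓘(ℝ, E)) (x := x))

end RealDerivative

section ComplexDerivative

variable {E : Type*} [NormedAddCommGroup E] [NormedSpace ℂ E]
  {M : Type*} [TopologicalSpace M] [ChartedSpace E M]
  {E' : Type*} [NormedAddCommGroup E'] [NormedSpace ℂ E']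
  {M' : Type*} [TopologicalSpace M'] [ChartedSpace E' M']

/-- The charts are the same over both fields, so the complex derivative with restricted scalars is a
real derivative, and derivatives are unique. -/
theorem modelDeriv_eq_complex {f : M → M'} {x : M}
    (hf : MDifferentiableAt 𝓘(ℂ, E) 𝓘(ℂ, E') f x) (v : E) :
    modelDeriv E E' f x v = (show E →L[ℂ] E' from mfderiv 𝓘(ℂ, E) 𝓘(ℂ, E') f x) v := by
  have h1 := hf.hasMFDerivAt
  let T : E →L[ℂ] E' := mfderiv 𝓘(ℂ, E) 𝓘(ℂ, E') f x
  let T' : E →L[ℝ] E' := T.restrictScalars ℝ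
  have h2 : HasMFDerivAt 𝓘(ℝ, E) 𝓘(ℝ, E') f x T' :=
    ⟨h1.1, HasFDerivWithinAt.restrictScalars ℝ (f' := T) h1.2⟩
  exact congrArg (fun T : E →L[ℝ] E' => T v) h2.mfderiv

theorem modelDeriv_smul_I {f : M → M'} {x : M}
    (hf : MDifferentiableAt 𝓘(ℂ, E) 𝓘(ℂ, E') f x) (v : E) :
    modelDeriv E E' f x (Complex.I • v) = Complex.I • modelDeriv E E' f x v := by
  rw [modelDeriv_eq_complex hf, modelDeriv_eq_complex hf]
  exact ContinuousLinearMap.map_smul (show E →L[ℂ] E' from mfderiv 𝓘(ℂ, E) 𝓘(ℂ, E') f x) _ v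

variable (E) in
/-- A complex Lie group is a real Lie group. -/
theorem LieGroup.restrictScalars_real (G : Type*) [TopologicalSpace G] [ChartedSpace E G] [Group G]
    [LieGroup 𝓘(ℂ, E) ω G] : LieGroup 𝓘(ℝ, E) ω G where
  contMDiff_mul := (contMDiff_mul 𝓘(ℂ, E) ω (G := G)).restrictScalars_real rfl rfl
  contMDiff_inv := (_root_.contMDiff_inv 𝓘(ℂ, E) ω (G := G)).restrictScalars_real rfl rfl

end ComplexDerivative

/-! ### The inverse function theorem on manifolds. -/

section InverseFunction

variable {𝕜 : Type*} [RCLike 𝕜]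
  {E : Type*} [NormedAddCommGroup E] [NormedSpace 𝕜 E] [CompleteSpace E]
  {M : Type*} [TopologicalSpace M] [ChartedSpace E M]
  {E' : Type*} [NormedAddCommGroup E'] [NormedSpace 𝕜 E']
  {M' : Type*} [TopologicalSpace M'] [ChartedSpace E' M']

/-- The inverse function theorem for analytic maps of manifolds. -/
theorem ContMDiff.isLocalDiffeomorphAt_of_mfderiv [IsManifold 𝓘(𝕜, E) ω M]
    [IsManifold 𝓘(𝕜, E') ω M'] {f : M → M'} (hf : ContMDiff 𝓘(𝕜, E) 𝓘(𝕜, E') ω f) (x : M)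
    (T : E ≃L[𝕜] E') (hT : (T : E →L[𝕜] E') = mfderiv 𝓘(𝕜, E) 𝓘(𝕜, E') f x) :
    IsLocalDiffeomorphAt 𝓘(𝕜, E) 𝓘(𝕜, E') ω f x := by
  set φ := chartAt E x with hφ
  set χ := chartAt E' (f x) with hχ
  set g : E → E' := fun y => χ (f (φ.symm y)) with hg
  have hgx : ContDiffAt 𝕜 ω g (φ x) := by
    have := (contMDiffAt_iff.1 (hf x)).2
    simpa [contDiffWithinAt_univ, Function.comp_def] using this
  have hder : HasFDerivAt g (T : E →L[𝕜] E') (φ x) := by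
    have := ((hf x).mdifferentiableAt (by simp)).hasMFDerivAt.2
    rw [← hT] at this
    have h2 : HasFDerivWithinAt g (T : E →L[𝕜] E') Set.univ (φ x) := by
      simp only [writtenInExtChartAt, mfld_simps] at this
      exact this
    exact hasFDerivWithinAt_univ.1 h2
  set e := hgx.toOpenPartialHomeomorph g hder (by simp) with he
  have hge : (e : E → E') = g := hgx.toOpenPartialHomeomorph_coe hder (by simp)
  have hinv : ContDiffAt 𝕜 ω e.symm (g (φ x)) := hgx.to_localInverse hder (by simp)
  -- The local inverse is known to be analytic only at the image point; analyticity at a point is an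
  -- open condition, which gives `V`.
  obtain ⟨V, hVx, hVo, hV⟩ : ∃ V : Set E', g (φ x) ∈ V ∧ IsOpen V ∧
      ∀ y ∈ V, ContDiffAt 𝕜 ω e.symm y := by
    obtain ⟨V, h1, h2, h3⟩ := eventually_nhds_iff.1 (hinv.eventually (by simp))
    exact ⟨V, h3, h2, h1⟩
  have hφx : x ∈ φ.source := mem_chart_source E x
  have hχx : f x ∈ χ.source := mem_chart_source E' (f x)
  have hgφ : g (φ x) = χ (f x) := by simp [hg, φ.left_inv hφx]
  have hopen : IsOpen (f ⁻¹' χ.source) := χ.open_source.preimage hf.continuous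
  -- The first restriction keeps `f` inside the chart `χ`, so that `Φ = f` on the source; the second
  -- makes the inverse analytic on the target.
  set Φ := ((φ.restrOpen _ hopen).trans e).trans (χ.symm.restrOpen V hVo) with hΦ
  have hsrc : ∀ p ∈ Φ.source, p ∈ φ.source ∧ f p ∈ χ.source ∧ Φ p = f p := by
    intro p hp
    have h1 : p ∈ φ.source ∧ f p ∈ χ.source := by
      simp [hΦ] at hp
      tauto
    refine ⟨h1.1, h1.2, ?_⟩
    simp [hΦ, hge, hg, φ.left_inv h1.1, χ.left_inv h1.2]
  refine ⟨⟨Φ.toPartialEquiv, Φ.open_source, Φ.open_target, ?_, ?_⟩, ?_, ?_⟩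
  · exact hf.contMDiffOn.congr fun p hp => (hsrc p hp).2.2
  · have h1 : ContMDiffOn 𝓘(𝕜, E') 𝓘(𝕜, E') ω χ Φ.target := by
      refine contMDiffOn_chart.mono fun q hq => ?_
      simp [hΦ] at hq
      tauto
    have h2 : ContMDiffOn 𝓘(𝕜, E') 𝓘(𝕜, E) ω e.symm (χ.target ∩ V ∩ e.target ∩ e.symm ⁻¹' φ.target) :=
      fun y hy => ((hV y hy.1.1.2).contMDiffAt).contMDiffWithinAt
    have h3 : ContMDiffOn 𝓘(𝕜, E) 𝓘(𝕜, E) ω φ.symm φ.target := contMDiffOn_chart_symm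
    refine (h3.comp (h2.comp h1 ?_) ?_).congr fun q hq => ?_
    · intro q hq
      simp [hΦ] at hq
      exact ⟨⟨⟨χ.map_source hq.1.1, hq.1.2⟩, hq.2.1⟩, hq.2.2.1⟩
    · intro q hq
      simp [hΦ] at hq
      exact hq.2.2.1
    · simp [hΦ]
  · have h1 : φ x ∈ e.source := hgx.mem_toOpenPartialHomeomorph_source hder (by simp)
    simp only [hΦ]
    simp [hge, hgφ, hφx, hχx, h1, χ.map_source hχx, hgφ ▸ hVx]
  · exact fun p hp => ((hsrc p hp).2.2).symm

end InverseFunction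

/-! ### `σ`-compactness of the group, and dimension under open maps. -/

section SigmaCompact

open Pointwise Topology

/-- A locally compact group with finitely many connected components is `σ`-compact. -/
theorem sigmaCompactSpace_of_finite_connectedComponents (G : Type*) [Group G] [TopologicalSpace G]
    [IsTopologicalGroup G] [LocallyCompactSpace G] [Finite (ConnectedComponents G)] :
    SigmaCompactSpace G := by
  obtain ⟨U, hU, hU1⟩ := exists_compact_mem_nhds (1 : G)
  -- `H` is open, hence closed, and is covered by the compact powers of `U ∪ U⁻¹`.
  let H : Subgroup G := Subgroup.closure U
  have hHo : IsOpen (H : Set G) :=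
    H.isOpen_of_mem_nhds (Filter.mem_of_superset hU1 Subgroup.subset_closure)
  have hHc : IsClosed (H : Set G) := OpenSubgroup.isClosed ⟨H, hHo⟩
  have hC : ∀ n : ℕ, IsCompact ((U ∪ U⁻¹) ^ n) := by
    intro n
    induction n with
    | zero => simp
    | succ n ih => rw [pow_succ]; exact ih.mul (hU.union hU.inv)
  have hinv : ((U ∪ U⁻¹)⁻¹ : Set G) = U ∪ U⁻¹ := by
    rw [Set.union_inv, inv_inv, Set.union_comm]
  have hsub : (H : Set G) ⊆ ⋃ n : ℕ, (U ∪ U⁻¹) ^ n := by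
    intro x hx
    rw [Set.mem_iUnion]
    induction hx using Subgroup.closure_induction with
    | mem x hx => exact ⟨1, by rw [pow_one]; exact Or.inl hx⟩
    | one => exact ⟨0, by simp⟩
    | mul x y _ _ hx hy =>
      obtain ⟨m, hm⟩ := hx
      obtain ⟨n, hn⟩ := hy
      exact ⟨m + n, by rw [pow_add]; exact Set.mul_mem_mul hm hn⟩
    | inv x _ hx =>
      obtain ⟨n, hn⟩ := hx
      refine ⟨n, ?_⟩
      rw [← hinv, inv_pow]
      exact Set.inv_mem_inv.2 hn
  have hH : IsSigmaCompact (H : Set G) :=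
    (isSigmaCompact_iUnion_of_isCompact _ hC).of_isClosed_subset hHc hsub
  have hdisc : DiscreteTopology (G ⧸ H) := QuotientGroup.discreteTopology hHo
  -- The quotient is discrete, so the projection factors through the connected components of `G`.
  have hfin : Finite (G ⧸ H) := by
    refine Finite.of_surjective (Continuous.connectedComponentsLift
      (continuous_quotient_mk' : Continuous (QuotientGroup.mk : G → G ⧸ H))) ?_
    intro q
    obtain ⟨g, rfl⟩ := QuotientGroup.mk_surjective q
    exact ⟨(g : ConnectedComponents G), rfl⟩
  rw [← isSigmaCompact_univ_iff]
  have huniv : (Set.univ : Set G) = ⋃ q : G ⧸ H, (fun x => q.out * x) '' (H : Set G) := by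
    symm
    refine Set.eq_univ_of_forall fun g => Set.mem_iUnion.2 ⟨(g : G ⧸ H), ?_⟩
    refine ⟨((g : G ⧸ H).out)⁻¹ * g, ?_, by simp⟩
    exact QuotientGroup.eq.1 (QuotientGroup.out_eq' (g : G ⧸ H))
  rw [huniv]
  exact isSigmaCompact_iUnion _ fun q => hH.image (continuous_const_mul _)

end SigmaCompact

section Dimension

variable {E : Type*} [NormedAddCommGroup E] [NormedSpace ℝ E] [FiniteDimensional ℝ E]
  {M : Type*} [TopologicalSpace M] [ChartedSpace E M]
  {E' : Type*} [NormedAddCommGroup E'] [NormedSpace ℝ E'] [FiniteDimensional ℝ E']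
  {M' : Type*} [TopologicalSpace M'] [ChartedSpace E' M']

/-- An open differentiable map does not raise the dimension. -/
theorem finrank_le_of_isOpenMap [Nonempty M] {f : M → M'} (hf : ContMDiff 𝓘(ℝ, E) 𝓘(ℝ, E') 1 f)
    (ho : IsOpenMap f) : Module.finrank ℝ E' ≤ Module.finrank ℝ E := by
  by_contra! hlt
  obtain ⟨x⟩ := ‹Nonempty M›
  set φ := chartAt E x with hφ
  set χ := chartAt E' (f x) with hχ
  have hφx : x ∈ φ.source := mem_chart_source E x
  have hχx : f x ∈ χ.source := mem_chart_source E' (f x)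
  set g : E → E' := fun y => χ (f (φ.symm y)) with hg
  have hgx : ContDiffAt ℝ 1 g (φ x) := by
    have := (contMDiffAt_iff.1 (hf x)).2
    simpa [contDiffWithinAt_univ, Function.comp_def] using this
  have hO : IsOpen (φ.target ∩ φ.symm ⁻¹' (f ⁻¹' χ.source)) :=
    φ.isOpen_inter_preimage_symm (χ.open_source.preimage hf.continuous)
  have hOx : φ.target ∩ φ.symm ⁻¹' (f ⁻¹' χ.source) ∈ nhds (φ x) := by
    refine hO.mem_nhds ⟨φ.map_source hφx, ?_⟩
    simpa [φ.left_inv hφx] using hχx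
  obtain ⟨r, hr, hball⟩ := Metric.mem_nhds_iff.1
    (Filter.inter_mem hOx (hgx.eventually (by simp)))
  have hcd : ContDiffOn ℝ 1 g (Metric.ball (φ x) r) :=
    fun y hy => ContDiffAt.contDiffWithinAt (hball hy).2
  -- The `C¹` image of a ball has Hausdorff dimension at most `dim E < dim E'`, so its complement is
  -- dense; this contradicts openness of the image.
  have hdense := hcd.dense_compl_image_of_dimH_lt_finrank (convex_ball _ _) subset_rfl
    ((dimH_mono (Set.subset_univ _)).trans_lt (by
      rw [Real.dimH_univ_eq_finrank]; exact_mod_cast hlt))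
  have himg : g '' Metric.ball (φ x) r = χ '' (f '' (φ.symm '' Metric.ball (φ x) r)) := by
    simp only [Set.image_image, hg]
  have hopen : IsOpen (g '' Metric.ball (φ x) r) := by
    rw [himg]
    refine χ.isOpen_image_of_subset_source (ho _ (φ.symm.isOpen_image_of_subset_source
      Metric.isOpen_ball fun y hy => (hball hy).1.1)) ?_
    rintro _ ⟨_, ⟨y, hy, rfl⟩, rfl⟩
    exact (hball hy).1.2
  obtain ⟨y, hy, hy'⟩ := hdense.inter_open_nonempty _ hopen
    ⟨_, Set.mem_image_of_mem _ (Metric.mem_ball_self hr)⟩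
  exact hy' hy

end Dimension

/-! ### The orbit map is a local biholomorphism. -/

section Orbit

variable {E : Type*} [NormedAddCommGroup E] [NormedSpace ℝ E] [CompleteSpace E]
  {G : Type*} [TopologicalSpace G] [ChartedSpace E G] [Group G] [LieGroup 𝓘(ℝ, E) ω G]
  {E' : Type*} [NormedAddCommGroup E'] [NormedSpace ℝ E']
  {Q : Type*} [TopologicalSpace Q] [ChartedSpace E' Q]

theorem mdifferentiableAt_of_contMDiff_omega {E₁ : Type*} [NormedAddCommGroup E₁] [NormedSpace ℝ E₁]
    {M : Type*} [TopologicalSpace M] [ChartedSpace E₁ M] {f : M → Q}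
    (hf : ContMDiff 𝓘(ℝ, E₁) 𝓘(ℝ, E') ω f) (x : M) : MDifferentiableAt 𝓘(ℝ, E₁) 𝓘(ℝ, E') f x :=
  (hf x).mdifferentiableAt (by simp)

omit [CompleteSpace E] in
theorem modelDeriv_mul_left_inv (g h : G) (v : E) :
    modelDeriv E E (fun x : G => g⁻¹ * x) (g * h) (modelDeriv E E (fun x : G => g * x) h v) = v := by
  rw [← modelDeriv_comp (E' := E) h
    (mdifferentiableAt_of_contMDiff_omega contMDiff_mul_left _)
    (mdifferentiableAt_of_contMDiff_omega contMDiff_mul_left _)]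
  simpa using modelDeriv_id h v

/-- A map from a Lie group which is equivariant for left translations and injective near the
identity has an injective derivative at the identity. -/
theorem eq_zero_of_modelDeriv_eq_zero_of_left_equivariant [IsManifold 𝓘(ℝ, E') ω Q] {f : G → Q}
    (hf : ContMDiff 𝓘(ℝ, E) 𝓘(ℝ, E') ω f) (R : G → Q → Q)
    (hR : ∀ g, ContMDiff 𝓘(ℝ, E') 𝓘(ℝ, E') ω (R g)) (hRf : ∀ g h, f (g * h) = R g (f h))
    {U : Set G} (hU : U ∈ nhds 1) (hUf : ∀ g ∈ U, f g = f 1 → g = 1)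
    (v : E) (hv : modelDeriv E E' f 1 v = 0) : v = 0 := by
  have hLG : LieGroup 𝓘(ℝ, E) (minSmoothness ℝ 3) G := LieGroup.of_le (n := ω) le_top
  have hM1 : IsManifold 𝓘(ℝ, E) 1 G := IsManifold.of_le (n := ω) le_top
  let V : ∀ g : G, TangentSpace 𝓘(ℝ, E) g :=
    fun g => mulInvariantVectorField (I := 𝓘(ℝ, E)) (show GroupLieAlgebra 𝓘(ℝ, E) G from v) g
  -- Differentiating `f (g * h) = R g (f h)` in `h` at `1` carries the vanishing at `1` to every
  -- `g`.
  have hVz : ∀ g, modelDeriv E E' f g (V g) = 0 := by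
    intro g
    have h1 : modelDeriv E E' (fun h => f (g * h)) 1 v = modelDeriv E E' f (g * 1) (V g) :=
      modelDeriv_comp (1 : G) (mdifferentiableAt_of_contMDiff_omega hf _)
        (mdifferentiableAt_of_contMDiff_omega contMDiff_mul_left _) v
    have h2 : modelDeriv E E' (fun h => f (g * h)) 1 v = 0 := by
      simp only [hRf]
      rw [modelDeriv_comp (1 : G) (mdifferentiableAt_of_contMDiff_omega (hR g) _)
        (mdifferentiableAt_of_contMDiff_omega hf _), hv, map_zero]
    rw [mul_one] at h1
    rw [← h1, h2]
  -- Along this integral curve of `V` the map `f` has zero derivative in a chart, so `f ∘ γ` is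
  -- locally constant. Then `hUf` gives `γ = 1` near `0`, and the velocity `v` at `0` vanishes.
  obtain ⟨γ, hγ0, hγ⟩ := exists_isMIntegralCurveAt_of_contMDiffAt (I := 𝓘(ℝ, E)) (v := V)
    (x₀ := (1 : G)) (t₀ := 0)
    ((contMDiffAt_mulInvariantVectorField (I := 𝓘(ℝ, E)) (g := (1 : G)) _).of_le
      (le_minSmoothness.trans' (by norm_num))) (BoundarylessManifold.isInteriorPoint)
  have hγc : ContinuousAt γ 0 := hγ.self_of_nhds.continuousAt
  set χ := extChartAt 𝓘(ℝ, E') (f 1)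
  have hsrc : ∀ᶠ t in nhds (0 : ℝ), f (γ t) ∈ (chartAt E' (f 1)).source := by
    refine (hf.continuous.continuousAt.comp hγc).eventually_mem ?_
    simpa [hγ0] using (chartAt E' (f 1)).open_source.mem_nhds (mem_chart_source E' (f 1))
  have hUt : ∀ᶠ t in nhds (0 : ℝ), γ t ∈ U := hγc.eventually_mem (by rwa [hγ0])
  obtain ⟨r, hr, hball⟩ := Metric.eventually_nhds_iff_ball.1 ((hγ.and hsrc).and hUt)
  have hder : ∀ t ∈ Metric.ball (0 : ℝ) r, HasFDerivAt (fun t => χ (f (γ t))) (0 : ℝ →L[ℝ] E') t := by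
    intro t ht
    have h1 := (hball t ht).1.1
    have h2 := (mdifferentiableAt_of_contMDiff_omega hf (γ t)).hasMFDerivAt
    have h3 := (mdifferentiableAt_extChartAt (I := 𝓘(ℝ, E')) (hball t ht).1.2).hasMFDerivAt
    let A : E' →L[ℝ] E' := mfderiv 𝓘(ℝ, E') 𝓘(ℝ, E') (extChartAt 𝓘(ℝ, E') (f 1)) (f (γ t))
    have h4 : HasFDerivAt (fun t => χ (f (γ t))) (A.comp ((modelDeriv E E' f (γ t)).comp
        ((1 : ℝ →L[ℝ] ℝ).smulRight (show E from V (γ t))))) t :=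
      (h3.comp t (h2.comp t h1)).hasFDerivAt
    have h5 : A.comp ((modelDeriv E E' f (γ t)).comp
        ((1 : ℝ →L[ℝ] ℝ).smulRight (show E from V (γ t)))) = 0 := by
      refine ContinuousLinearMap.ext_ring ?_
      change A (modelDeriv E E' f (γ t) ((1 : ℝ) • (show E from V (γ t)))) = 0
      rw [one_smul]
      exact (congrArg A (hVz (γ t))).trans (map_zero A)
    rwa [h5] at h4
  have hconst : ∀ t ∈ Metric.ball (0 : ℝ) r, γ t = 1 := by
    intro t ht
    have h0 : (0 : ℝ) ∈ Metric.ball (0 : ℝ) r := Metric.mem_ball_self hr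
    have h1 : χ (f (γ t)) = χ (f (γ 0)) :=
      Metric.isOpen_ball.is_const_of_fderiv_eq_zero (convex_ball _ _).isPreconnected
        (fun s hs => (hder s hs).differentiableAt.differentiableWithinAt)
        (fun s hs => (hder s hs).fderiv) ht h0
    have h2 : f (γ t) = f (γ 0) := (extChartAt 𝓘(ℝ, E') (f 1)).injOn
      (by simpa using (hball t ht).1.2) (by simpa using (hball 0 h0).1.2) h1
    rw [hγ0] at h2
    exact hUf _ (hball t ht).2 h2
  have hev : γ =ᶠ[nhds 0] fun _ => (1 : G) :=
    Filter.eventually_of_mem (Metric.ball_mem_nhds _ hr) hconst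
  have h1 := hγ.self_of_nhds
  have h2 : HasMFDerivAt 𝓘(ℝ, ℝ) 𝓘(ℝ, E) γ 0 (0 : ℝ →L[ℝ] E) :=
    (hasMFDerivAt_const (1 : G) (0 : ℝ)).congr_of_eventuallyEq hev
  have h3 := hasMFDerivAt_unique h1 h2
  have h4 : V (γ 0) = (0 : E) :=
    (one_smul ℝ (show E from V (γ 0))).symm.trans (congrArg (fun T : ℝ →L[ℝ] E => T 1) h3)
  rw [hγ0] at h4
  have h5 : modelDeriv E E (fun x : G => 1 * x) 1 v = 0 := h4
  simpa [modelDeriv_id] using h5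

/-- A map from a Lie group which is equivariant for right translations and injective near the
identity has an injective derivative at the identity. -/
theorem eq_zero_of_modelDeriv_eq_zero_of_right_equivariant [IsManifold 𝓘(ℝ, E') ω Q] {f : G → Q}
    (hf : ContMDiff 𝓘(ℝ, E) 𝓘(ℝ, E') ω f) (R : G → Q → Q)
    (hR : ∀ g, ContMDiff 𝓘(ℝ, E') 𝓘(ℝ, E') ω (R g)) (hRf : ∀ g h, f (h * g) = R g (f h))
    {U : Set G} (hU : U ∈ nhds 1) (hUf : ∀ g ∈ U, f g = f 1 → g = 1)
    (v : E) (hv : modelDeriv E E' f 1 v = 0) : v = 0 := by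
  have hinv : ContMDiff 𝓘(ℝ, E) 𝓘(ℝ, E) ω (fun g : G => g⁻¹) := contMDiff_inv 𝓘(ℝ, E) ω
  -- Inversion exchanges right and left equivariance. The left case shows that the derivative of
  -- inversion kills `v`; inversion is an involution, so `v = 0`.
  have hF : ContMDiff 𝓘(ℝ, E) 𝓘(ℝ, E') ω (fun g => f g⁻¹) := hf.comp hinv
  have hgrp : IsTopologicalGroup G := topologicalGroup_of_lieGroup 𝓘(ℝ, E) ω
  have hd := mdifferentiableAt_of_contMDiff_omega hinv
  have h1 : modelDeriv E E (fun g : G => g⁻¹) 1 v = 0 := by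
    refine eq_zero_of_modelDeriv_eq_zero_of_left_equivariant hF (fun g => R g⁻¹) (fun g => hR _)
      (fun g h => by simp [hRf]) (U := U⁻¹) (inv_mem_nhds_one G hU)
      (fun g hg h => inv_eq_one.1 (hUf _ hg (by simpa using h))) _ ?_
    have := modelDeriv_comp (1 : G) (mdifferentiableAt_of_contMDiff_omega hF _) (hd 1) v
    rw [inv_one] at this
    simpa [hv] using this.symm
  have h2 := modelDeriv_comp (1 : G) (hd _) (hd 1) v
  rw [h1, map_zero] at h2
  simpa [modelDeriv_id] using h2

end Orbit

section OrbitMap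

open Topology

variable {E : Type*} [NormedAddCommGroup E] [NormedSpace ℂ E]
  {G : Type*} [TopologicalSpace G] [ChartedSpace E G] [Group G]
  {E' : Type*} [NormedAddCommGroup E'] [NormedSpace ℂ E']
  {Q : Type*} [TopologicalSpace Q] [ChartedSpace E' Q] [MulAction Gᵐᵒᵖ Q]

omit [TopologicalSpace G] [TopologicalSpace Q] in
theorem rightAct_mul (q : Q) (g h : G) : q <• (g * h) = q <• g <• h := by
  rw [MulOpposite.op_mul, mul_smul]

omit [TopologicalSpace G] [TopologicalSpace Q] in
theorem rightAct_mul_inv (q : Q) (g : G) : q <• g <• g⁻¹ = q := by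
  rw [← rightAct_mul, mul_inv_cancel, MulOpposite.op_one, one_smul]

theorem contMDiff_orbitMap (hol : ContMDiff (𝓘(ℂ, E').prod 𝓘(ℂ, E)) 𝓘(ℂ, E') ω
    (fun x : Q × G => x.1 <• x.2)) (q : Q) :
    ContMDiff 𝓘(ℂ, E) 𝓘(ℂ, E') ω (fun g : G => q <• g) :=
  hol.comp (contMDiff_const.prodMk contMDiff_id)

theorem contMDiff_rightAct (hol : ContMDiff (𝓘(ℂ, E').prod 𝓘(ℂ, E)) 𝓘(ℂ, E') ω
    (fun x : Q × G => x.1 <• x.2)) (g : G) :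
    ContMDiff 𝓘(ℂ, E') 𝓘(ℂ, E') ω (fun q : Q => q <• g) :=
  hol.comp (contMDiff_id.prodMk contMDiff_const)

-- Discreteness of the stabiliser, in the form of injectivity near the identity that the kernel
-- argument needs.
omit [TopologicalSpace Q] in
theorem exists_nhds_stabilizer_eq_one {q₀ : Q}
    (hdisc : DiscreteTopology {g : G | q₀ <• g = q₀}) :
    ∃ U ∈ 𝓝 (1 : G), ∀ g ∈ U, q₀ <• g = q₀ <• (1 : G) → g = 1 := by
  have h1 : q₀ <• (1 : G) = q₀ := by simp
  have h := (isOpen_discrete ({⟨1, h1⟩} : Set {g : G | q₀ <• g = q₀})).mem_nhds rfl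
  obtain ⟨U, hU, hUs⟩ := (mem_nhds_subtype _ _ _).1 h
  refine ⟨U, hU, fun g hg hgq => ?_⟩
  have h2 : (⟨g, hgq.trans h1⟩ : {g : G | q₀ <• g = q₀}) ∈ ({⟨1, h1⟩} : Set _) := hUs hg
  exact congrArg Subtype.val h2

variable [LieGroup 𝓘(ℂ, E) ω G] [IsManifold 𝓘(ℂ, E') ω Q]

variable [FiniteDimensional ℂ E]

/-- The derivative of the orbit map of a point with discrete stabiliser is injective. -/
theorem modelDeriv_orbitMap_injective (hol : ContMDiff (𝓘(ℂ, E').prod 𝓘(ℂ, E)) 𝓘(ℂ, E') ω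
    (fun x : Q × G => x.1 <• x.2)) {q₀ : Q} (hdisc : DiscreteTopology {g : G | q₀ <• g = q₀})
    (g : G) : Function.Injective (modelDeriv E E' (fun h : G => q₀ <• h) g) := by
  have hLG : LieGroup 𝓘(ℝ, E) ω G := LieGroup.restrictScalars_real E G
  have hCE : CompleteSpace E := FiniteDimensional.complete ℂ E
  have hψ : ContMDiff 𝓘(ℝ, E) 𝓘(ℝ, E') ω (fun h : G => q₀ <• h) :=
    (contMDiff_orbitMap hol q₀).restrictScalars_real rfl rfl
  have hR : ∀ g : G, ContMDiff 𝓘(ℝ, E') 𝓘(ℝ, E') ω (fun q : Q => q <• g) :=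
    fun g => (contMDiff_rightAct hol g).restrictScalars_real rfl rfl
  have hmul : ∀ g : G, ContMDiff 𝓘(ℝ, E) 𝓘(ℝ, E) ω (fun x : G => x * g) :=
    fun g => contMDiff_mul_right
  obtain ⟨U, hU, hUψ⟩ := exists_nhds_stabilizer_eq_one hdisc
  have h1 := eq_zero_of_modelDeriv_eq_zero_of_right_equivariant hψ (fun g q => q <• g) hR
    (fun g h => rightAct_mul q₀ h g) hU hUψ
  rw [injective_iff_map_eq_zero]
  intro v hv
  -- Right translation by `g⁻¹` moves the kernel vector to the identity, where `h1` applies;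
  -- translating back by `g` recovers `v`.
  have h2 : modelDeriv E E' (fun h : G => q₀ <• (h * g⁻¹)) g v = 0 := by
    simp only [rightAct_mul]
    rw [modelDeriv_comp g (mdifferentiableAt_of_contMDiff_omega (hR g⁻¹) _)
      (mdifferentiableAt_of_contMDiff_omega hψ _), hv, map_zero]
  rw [modelDeriv_comp (M' := G) (E' := E) (g := fun h : G => q₀ <• h) g
    (mdifferentiableAt_of_contMDiff_omega hψ _)
    (mdifferentiableAt_of_contMDiff_omega (hmul g⁻¹) _), mul_inv_cancel] at h2
  have h3 := h1 _ h2
  have h4 := modelDeriv_comp (g := fun h : G => h * g) (f := fun h : G => h * g⁻¹) (E'' := E) g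
    (mdifferentiableAt_of_contMDiff_omega (hmul g) _)
    (mdifferentiableAt_of_contMDiff_omega (hmul g⁻¹) _) v
  rw [h3, map_zero] at h4
  simpa [modelDeriv_id] using h4

variable [FiniteDimensional ℂ E'] [T2Space Q]

-- The open mapping theorem for a transitive action of a `σ`-compact group on a locally compact
-- Hausdorff space. The finiteness of the set of components enters here.
omit [IsManifold 𝓘(ℂ, E') ω Q] in
theorem isOpenMap_orbitMap [MulAction.IsPretransitive Gᵐᵒᵖ Q] [Finite (ConnectedComponents G)]
    (hol : ContMDiff (𝓘(ℂ, E').prod 𝓘(ℂ, E)) 𝓘(ℂ, E') ω (fun x : Q × G => x.1 <• x.2)) (q : Q) :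
    IsOpenMap (fun g : G => q <• g) := by
  have hgrp : IsTopologicalGroup G := topologicalGroup_of_lieGroup 𝓘(ℂ, E) ω
  have hpE : ProperSpace E := FiniteDimensional.proper ℂ E
  have hpE' : ProperSpace E' := FiniteDimensional.proper ℂ E'
  have hlG : LocallyCompactSpace G := ChartedSpace.locallyCompactSpace E G
  have hlQ : LocallyCompactSpace Q := ChartedSpace.locallyCompactSpace E' Q
  have hσ : SigmaCompactSpace G := sigmaCompactSpace_of_finite_connectedComponents G
  have hσ' : SigmaCompactSpace Gᵐᵒᵖ :=
    MulOpposite.opHomeomorph.symm.isClosedEmbedding.sigmaCompactSpace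
  have hsmul : ContinuousSMul Gᵐᵒᵖ Q :=
    ⟨hol.continuous.comp (continuous_snd.prodMk (MulOpposite.continuous_unop.comp continuous_fst))⟩
  exact (isOpenMap_smul_of_sigmaCompact (G := Gᵐᵒᵖ) q).comp MulOpposite.opHomeomorph.isOpenMap

/-- Injectivity of the derivative gives one inequality, openness of the orbit map the other. -/
theorem finrank_eq_of_discrete_stabilizer [MulAction.IsPretransitive Gᵐᵒᵖ Q]
    [Finite (ConnectedComponents G)]
    (hol : ContMDiff (𝓘(ℂ, E').prod 𝓘(ℂ, E)) 𝓘(ℂ, E') ω (fun x : Q × G => x.1 <• x.2))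
    {q₀ : Q} (hdisc : DiscreteTopology {g : G | q₀ <• g = q₀}) :
    Module.finrank ℝ E = Module.finrank ℝ E' := by
  refine le_antisymm ?_ ?_
  · exact LinearMap.finrank_le_finrank_of_injective
      (f := (modelDeriv E E' (fun h : G => q₀ <• h) 1).toLinearMap)
      (modelDeriv_orbitMap_injective hol hdisc 1)
  · have hψ : ContMDiff 𝓘(ℝ, E) 𝓘(ℝ, E') ω (fun h : G => q₀ <• h) :=
      (contMDiff_orbitMap hol q₀).restrictScalars_real rfl rfl
    exact finrank_le_of_isOpenMap (hψ.of_le le_top) (isOpenMap_orbitMap hol q₀)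

theorem modelDeriv_orbitMap_bijective [MulAction.IsPretransitive Gᵐᵒᵖ Q]
    [Finite (ConnectedComponents G)]
    (hol : ContMDiff (𝓘(ℂ, E').prod 𝓘(ℂ, E)) 𝓘(ℂ, E') ω (fun x : Q × G => x.1 <• x.2))
    {q₀ : Q} (hdisc : DiscreteTopology {g : G | q₀ <• g = q₀}) (g : G) :
    Function.Bijective (modelDeriv E E' (fun h : G => q₀ <• h) g) := by
  have h := modelDeriv_orbitMap_injective hol hdisc g
  exact ⟨h, (LinearMap.injective_iff_surjective_of_finrank_eq_finrank
    (f := (modelDeriv E E' (fun h : G => q₀ <• h) g).toLinearMap)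
    (finrank_eq_of_discrete_stabilizer hol hdisc)).1 h⟩

/-- The orbit map of a point with discrete stabiliser is a local biholomorphism. -/
theorem isLocalDiffeomorph_orbitMap [MulAction.IsPretransitive Gᵐᵒᵖ Q]
    [Finite (ConnectedComponents G)]
    (hol : ContMDiff (𝓘(ℂ, E').prod 𝓘(ℂ, E)) 𝓘(ℂ, E') ω (fun x : Q × G => x.1 <• x.2))
    {q₀ : Q} (hdisc : DiscreteTopology {g : G | q₀ <• g = q₀}) :
    IsLocalDiffeomorph 𝓘(ℂ, E) 𝓘(ℂ, E') ω (fun g : G => q₀ <• g) := by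
  intro g
  have hCE : CompleteSpace E := FiniteDimensional.complete ℂ E
  have hψ := contMDiff_orbitMap hol q₀
  let T : E →L[ℂ] E' := mfderiv 𝓘(ℂ, E) 𝓘(ℂ, E') (fun g : G => q₀ <• g) g
  have hT : Function.Bijective T := by
    have h := modelDeriv_orbitMap_bijective hol hdisc g
    have h' : (T : E → E') = modelDeriv E E' (fun h : G => q₀ <• h) g :=
      funext fun v => (modelDeriv_eq_complex ((hψ g).mdifferentiableAt (by simp)) v).symm
    rwa [h']
  exact hψ.isLocalDiffeomorphAt_of_mfderiv g
    (LinearEquiv.ofBijective T.toLinearMap hT).toContinuousLinearEquiv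
    (ContinuousLinearMap.ext fun v => rfl)

end OrbitMap

theorem orbitMap_surjective {G Q : Type*} [Group G] [MulAction Gᵐᵒᵖ Q]
    [MulAction.IsPretransitive Gᵐᵒᵖ Q] (q₀ : Q) :
    Function.Surjective (fun g : G => q₀ <• g) := by
  intro q
  obtain ⟨g, hg⟩ := MulAction.exists_smul_eq Gᵐᵒᵖ q₀ q
  exact ⟨g.unop, hg⟩

/-! ### The left Maurer–Cartan form. -/

section MaurerCartan

variable {E : Type*} [NormedAddCommGroup E] [NormedSpace ℝ E]

/-- The trivialisation centred at `x` is the identity on the fibre over `x`. This reads a smooth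
bundle-valued map with constant base point as a smooth map to `E`. -/
theorem TangentBundle.trivializationAt_snd_of_proj_eq {M : Type*} [TopologicalSpace M]
    [ChartedSpace E M] [IsManifold 𝓘(ℝ, E) 1 M] (x : M) (w : TangentBundle 𝓘(ℝ, E) M)
    (h : w.proj = x) :
    (trivializationAt E (TangentSpace 𝓘(ℝ, E) : M → Type _) x w).2 = w.snd := by
  subst h
  exact (tangentBundleCore 𝓘(ℝ, E) M).coordChange_self (achart E w.proj) w.proj
    (mem_chart_source E w.proj) w.snd

variable {G : Type*} [TopologicalSpace G] [ChartedSpace E G] [Group G]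

variable (E) in
/-- The left Maurer–Cartan form of a Lie group. -/
noncomputable def maurerCartan (g : G) : E →L[ℝ] E := modelDeriv E E (fun x : G => g⁻¹ * x) g

variable (E) in
/-- The derivative at the identity of the left translation by `g`. -/
noncomputable def leftTranslate (g : G) : E →L[ℝ] E := modelDeriv E E (fun x : G => g * x) 1

variable [LieGroup 𝓘(ℝ, E) ω G]

theorem maurerCartan_leftTranslate (g : G) (v : E) :
    maurerCartan E g (leftTranslate E g v) = v := by
  have := modelDeriv_mul_left_inv g 1 v
  rwa [mul_one] at this

theorem mdifferentiableAt_mul_left' (g x : G) :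
    MDifferentiableAt 𝓘(ℝ, E) 𝓘(ℝ, E) (fun x : G => g * x) x :=
  mdifferentiableAt_of_contMDiff_omega contMDiff_mul_left _

theorem mdifferentiableAt_mul_right' (g x : G) :
    MDifferentiableAt 𝓘(ℝ, E) 𝓘(ℝ, E) (fun x : G => x * g) x :=
  mdifferentiableAt_of_contMDiff_omega contMDiff_mul_right _

theorem leftTranslate_maurerCartan (g : G) (v : E) :
    leftTranslate E g (maurerCartan E g v) = v := by
  have := modelDeriv_comp g (mdifferentiableAt_mul_left' (E := E) g (g⁻¹ * g))
    (mdifferentiableAt_mul_left' (E := E) g⁻¹ g) v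
  simp only [mul_inv_cancel_left, inv_mul_cancel] at this
  exact this.symm.trans (modelDeriv_id g v)

/-- `(a g)⁻¹ (a x) = g⁻¹ x`. This invariance is what lets the form descend along the orbit map. -/
theorem maurerCartan_mul_left (a g : G) (v : E) :
    maurerCartan E (a * g) (modelDeriv E E (fun x : G => a * x) g v) = maurerCartan E g v := by
  rw [maurerCartan, ← modelDeriv_comp g (mdifferentiableAt_mul_left' (E := E) (a * g)⁻¹ (a * g))
    (mdifferentiableAt_mul_left' (E := E) a g)]
  simp only [mul_inv_rev, mul_assoc, inv_mul_cancel_left]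
  rfl

/-- `(g k)⁻¹ (x k) = k⁻¹ (g⁻¹ x) k`. Keeping `k⁻¹⁻¹` makes the right side literally `modelAd E k⁻¹`.
-/
theorem maurerCartan_mul_right (g k : G) (v : E) :
    maurerCartan E (g * k) (modelDeriv E E (fun x : G => x * k) g v)
      = modelDeriv E E (fun x : G => k⁻¹ * x * k⁻¹⁻¹) 1 (maurerCartan E g v) := by
  have hd : MDifferentiableAt 𝓘(ℝ, E) 𝓘(ℝ, E) (fun x : G => k⁻¹ * x * k⁻¹⁻¹) (g⁻¹ * g) :=
    (mdifferentiableAt_mul_right' _ _).comp _ (mdifferentiableAt_mul_left' _ _)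
  have h1 := modelDeriv_comp (g := fun x : G => k⁻¹ * x * k⁻¹⁻¹) g hd
    (mdifferentiableAt_mul_left' (E := E) g⁻¹ g) v
  rw [inv_mul_cancel] at h1
  rw [maurerCartan, maurerCartan, ← h1,
    ← modelDeriv_comp g (mdifferentiableAt_mul_left' (E := E) (g * k)⁻¹ (g * k))
    (mdifferentiableAt_mul_right' (E := E) k g)]
  simp only [mul_inv_rev, mul_assoc, inv_inv]

/-- The form at `(g, v)` is the tangent map of `(a, b) ↦ a⁻¹ b` applied to `(0, v)` over `(g, g)`, a
composite of smooth maps whose base point is always `1`. -/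
theorem contMDiff_maurerCartan :
    ContMDiff 𝓘(ℝ, E).tangent 𝓘(ℝ, E) ∞
      (fun v : TangentBundle 𝓘(ℝ, E) G => maurerCartan E v.proj v.snd) := by
  have hM1 : IsManifold 𝓘(ℝ, E) 1 G := IsManifold.of_le (n := ω) le_top
  have hP : ContMDiff (𝓘(ℝ, E).prod 𝓘(ℝ, E)) 𝓘(ℝ, E) ω (fun p : G × G => p.1⁻¹ * p.2) :=
    (contMDiff_mul 𝓘(ℝ, E) ω).comp
      (((contMDiff_inv 𝓘(ℝ, E) ω).comp contMDiff_fst).prodMk contMDiff_snd)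
  let F₁ : TangentBundle 𝓘(ℝ, E) G → TangentBundle 𝓘(ℝ, E) G × TangentBundle 𝓘(ℝ, E) G :=
    fun v => (Bundle.zeroSection E (TangentSpace 𝓘(ℝ, E)) v.proj, v)
  have S₁ : ContMDiff 𝓘(ℝ, E).tangent (𝓘(ℝ, E).tangent.prod 𝓘(ℝ, E).tangent) ∞ F₁ :=
    ((Bundle.contMDiff_zeroSection ℝ _).comp (Bundle.contMDiff_proj _)).prodMk contMDiff_id
  let F₂ := (equivTangentBundleProd 𝓘(ℝ, E) G 𝓘(ℝ, E) G).symm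
  have S₂ : ContMDiff (𝓘(ℝ, E).tangent.prod 𝓘(ℝ, E).tangent)
      (𝓘(ℝ, E).prod 𝓘(ℝ, E)).tangent ∞ F₂ := contMDiff_equivTangentBundleProd_symm
  have S₃ := hP.contMDiff_tangentMap (m := ∞) le_top
  have S := (S₃.comp S₂).comp S₁
  intro v
  have h := (Bundle.contMDiffAt_totalSpace.1 (S v)).2
  refine h.congr_of_eventuallyEq (Filter.Eventually.of_forall fun w => ?_)
  symm
  refine (TangentBundle.trivializationAt_snd_of_proj_eq _ _ ?_).trans ?_
  · change w.proj⁻¹ * w.proj = v.proj⁻¹ * v.proj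
    simp
  · have h1 := mfderiv_prod_eq_add_apply (p := (w.proj, w.proj))
      (v := show E × E from (0, show E from w.snd)) ((hP _).mdifferentiableAt (by simp))
    refine h1.trans ?_
    let A : E →L[ℝ] E := mfderiv 𝓘(ℝ, E) 𝓘(ℝ, E) (fun z : G => z⁻¹ * w.proj) w.proj
    change A 0 + maurerCartan E w.proj w.snd = maurerCartan E w.proj w.snd
    rw [map_zero, zero_add]

end MaurerCartan

/-! ### Real and imaginary parts in `𝔤 = 𝔨 ⊕ i𝔨`. -/

/-- The adjoint action of `a`, as a map of the model space. -/
noncomputable def modelAd (E : Type*) [NormedAddCommGroup E] [NormedSpace ℝ E] {G : Type*}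
    [TopologicalSpace G] [ChartedSpace E G] [Group G] (a : G) : E →L[ℝ] E :=
  modelDeriv E E (fun x : G => a * x * a⁻¹) 1

section ReIm

variable {F : Type*} [NormedAddCommGroup F] [NormedSpace ℝ F]
  {K : Type*} [TopologicalSpace K] [ChartedSpace F K] [Group K]
  {E : Type*} [NormedAddCommGroup E] [NormedSpace ℂ E]
  {G : Type*} [TopologicalSpace G] [ChartedSpace E G] [Group G]

/-- The map `(X, Y) ↦ X + i Y` from `𝔨 × 𝔨` to `𝔤`. -/
noncomputable def ofReIm (ι : K →* G) : F × F →L[ℝ] E :=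
  (modelDeriv F E ι 1).coprod (((Complex.I • ContinuousLinearMap.id ℂ E).restrictScalars ℝ).comp
    (modelDeriv F E ι 1))

theorem ofReIm_apply (ι : K →* G) (z : F × F) :
    ofReIm (E := E) ι z = modelDeriv F E ι 1 z.1 + Complex.I • modelDeriv F E ι 1 z.2 := by
  simp [ofReIm]

theorem smul_I_ofReIm (ι : K →* G) (z : F × F) :
    Complex.I • ofReIm (E := E) ι z = ofReIm ι (-z.2, z.1) := by
  simp only [ofReIm_apply, smul_add, smul_smul, Complex.I_mul_I, map_neg, neg_smul, one_smul]
  abel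

variable [LieGroup 𝓘(ℝ, F) ∞ K] [LieGroup 𝓘(ℂ, E) ω G]

theorem modelAd_smul_I (a : G) (v : E) :
    modelAd E a (Complex.I • v) = Complex.I • modelAd E a v := by
  have h : ContMDiff 𝓘(ℂ, E) 𝓘(ℂ, E) ω (fun x : G => a * x * a⁻¹) :=
    contMDiff_mul_right.comp contMDiff_mul_left
  exact modelDeriv_smul_I ((h 1).mdifferentiableAt (by simp)) v

variable {ι : K →* G}

theorem modelAd_modelDeriv (hι : ContMDiff 𝓘(ℝ, F) 𝓘(ℝ, E) ∞ ι) (k : K) (X : F) :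
    modelAd E (ι k) (modelDeriv F E ι 1 X) = modelDeriv F E ι 1 (modelAd F k X) := by
  have hG : LieGroup 𝓘(ℝ, E) ω G := LieGroup.restrictScalars_real E G
  have hdι := fun k => (hι k).mdifferentiableAt (by simp)
  have hc : ContMDiff 𝓘(ℝ, E) 𝓘(ℝ, E) ω (fun x : G => ι k * x * (ι k)⁻¹) :=
    contMDiff_mul_right.comp contMDiff_mul_left
  have hc' : ContMDiff 𝓘(ℝ, F) 𝓘(ℝ, F) ∞ (fun x : K => k * x * k⁻¹) :=
    contMDiff_mul_right.comp contMDiff_mul_left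
  have h1 := modelDeriv_comp (g := fun x : G => ι k * x * (ι k)⁻¹) (f := ι) (1 : K)
    (mdifferentiableAt_of_contMDiff_omega hc _) (hdι 1) X
  have h2 := modelDeriv_comp (g := ι) (f := fun x : K => k * x * k⁻¹) (1 : K)
    (hdι _) ((hc' 1).mdifferentiableAt (by simp)) X
  simp only [map_mul, map_inv, map_one, mul_one, mul_inv_cancel] at h1 h2
  exact h1.symm.trans h2

/-- `Ad` of `K` is complex linear, because conjugation is holomorphic, and it preserves `𝔨`, so it
acts on the two parts separately. -/
theorem modelAd_ofReIm (hι : ContMDiff 𝓘(ℝ, F) 𝓘(ℝ, E) ∞ ι) (k : K) (z : F × F) :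
    modelAd E (ι k) (ofReIm ι z) = ofReIm ι (modelAd F k z.1, modelAd F k z.2) := by
  simp only [ofReIm_apply, map_add, modelAd_smul_I, modelAd_modelDeriv hι]

variable [FiniteDimensional ℝ F] [CompactSpace K]

/-- The decomposition `𝔤 = 𝔨 ⊕ i 𝔨` of the Lie algebra of a complexification. -/
noncomputable def reIm (hι : IsComplexification (F := F) (E := E) ι) : E ≃L[ℝ] F × F :=
  (LinearEquiv.ofBijective (ofReIm (F := F) (E := E) ι).toLinearMap (by
    have h : (ofReIm ι : F × F → E) = fun z => complexElement ι z.1 z.2 :=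
      funext (ofReIm_apply ι)
    change Function.Bijective (ofReIm ι)
    rw [h]
    exact hι.lieAlgebra)).toContinuousLinearEquiv.symm

omit [LieGroup 𝓘(ℝ, F) ∞ K] [LieGroup 𝓘(ℂ, E) ω G] in
theorem reIm_ofReIm (hι : IsComplexification (F := F) (E := E) ι) (z : F × F) :
    reIm hι (ofReIm ι z) = z :=
  (reIm hι).apply_symm_apply z

omit [LieGroup 𝓘(ℝ, F) ∞ K] [LieGroup 𝓘(ℂ, E) ω G] in
theorem ofReIm_reIm (hι : IsComplexification (F := F) (E := E) ι) (v : E) :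
    ofReIm ι (reIm hι v) = v :=
  (reIm hι).symm_apply_apply v

omit [LieGroup 𝓘(ℝ, F) ∞ K] [LieGroup 𝓘(ℂ, E) ω G] in
theorem reIm_modelDeriv (hι : IsComplexification (F := F) (E := E) ι) (X : F) :
    reIm hι (modelDeriv F E ι 1 X) = (X, 0) := by
  rw [← reIm_ofReIm hι (X, 0), ofReIm_apply]
  simp

theorem reIm_modelAd (hι : IsComplexification (F := F) (E := E) ι) (k : K) (v : E) :
    reIm hι (modelAd E (ι k) v) = (modelAd F k (reIm hι v).1, modelAd F k (reIm hι v).2) := by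
  rw [← reIm_ofReIm hι (modelAd F k (reIm hι v).1, modelAd F k (reIm hι v).2),
    ← modelAd_ofReIm hι.smooth, ofReIm_reIm]

end ReIm

/-! ### From equivariant coframes to the data of the main construction. -/

section Coframe

variable {F : Type*} [NormedAddCommGroup F] [NormedSpace ℝ F]
  {K : Type*} [TopologicalSpace K] [ChartedSpace F K] [Group K] [CompactSpace K]
  {P : Type*} [TopologicalSpace P]

theorem MainData.ext_of_conn_form {V : Type*} [NormedAddCommGroup V] [NormedSpace ℝ V]
    [ChartedSpace V P] [IsManifold 𝓘(ℝ, V) ∞ P] {ρ : P → K → P}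
    {D D' : MainData (F := F) (E := V) ρ} (h : D.conn = D'.conn) (h' : D.form = D'.form) :
    D = D' := by
  cases D
  cases D'
  cases h
  cases h'
  rfl

/-- The almost complex structure on a vector, in terms of the horizontal lift of its vertical
component. -/
theorem MainData.J_apply {V : Type*} [NormedAddCommGroup V] [NormedSpace ℝ V]
    [ChartedSpace V P] [IsManifold 𝓘(ℝ, V) ∞ P] {ρ : P → K → P}
    (D : MainData (F := F) (E := V) ρ) (p : P) (w h : TangentSpace 𝓘(ℝ, V) p)
    (hh : D.conn p h = 0) (hw : D.form p h = D.conn p w) :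
    D.J p w = fundamental ρ p (D.form p w) - h := by
  have h1 : (D.formEquiv p).symm (D.conn p w) = ⟨h, hh⟩ := by
    rw [LinearEquiv.symm_apply_eq]
    exact hw.symm
  change fundamental ρ p (D.form p w)
    - (D.horizontal p).subtype ((D.formEquiv p).symm (D.conn p w)) = _
  rw [h1]
  rfl

variable {V : Type*} [NormedAddCommGroup V] [NormedSpace ℝ V]
  [ChartedSpace V P] [IsManifold 𝓘(ℝ, V) ∞ P]
  {E : Type*} [NormedAddCommGroup E] [NormedSpace ℂ E]
  {G : Type*} [TopologicalSpace G] [ChartedSpace E G] [Group G]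
  [LieGroup 𝓘(ℝ, F) ∞ K] [LieGroup 𝓘(ℂ, E) ω G] [FiniteDimensional ℝ F] {ι : K →* G}

/-- An equivariant parallelism of a principal `K`-manifold with values in the Lie algebra of the
complexification of `K`. -/
structure IsEquivariantCoframe (ι : K →* G) (ρ : P → K → P) (θ : P → V →L[ℝ] E) : Prop where
  principal : IsPrincipalAction (F := F) (E := V) ρ
  smooth : ContMDiff 𝓘(ℝ, V).tangent 𝓘(ℝ, E) ∞
    (fun v : TangentBundle 𝓘(ℝ, V) P => θ v.proj v.snd)
  equivariant : ∀ (p : P) (k : K) (v : V),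
    θ (ρ p k) (modelDeriv V V (fun x => ρ x k) p v) = modelAd E (ι k⁻¹) (θ p v)
  fundamental : ∀ (p : P) (X : F), θ p (modelDeriv F V (ρ p) 1 X) = modelDeriv F E ι 1 X
  bijective : ∀ p, Function.Bijective (θ p)

theorem IsEquivariantCoframe.reIm_apply (hι : IsComplexification (F := F) (E := E) ι)
    {ρ : P → K → P} {θ : P → V →L[ℝ] E} (hθ : IsEquivariantCoframe (F := F) ι ρ θ)
    (p : P) (k : K) (v : V) :
    reIm hι (θ (ρ p k) (modelDeriv V V (fun x => ρ x k) p v)) =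
      (modelAd F k⁻¹ (reIm hι (θ p v)).1, modelAd F k⁻¹ (reIm hι (θ p v)).2) := by
  rw [hθ.equivariant, reIm_modelAd]

/-- The connection and tensorial form which are the components `X` and `-Y` of an equivariant
coframe with values `X + i Y`. -/
noncomputable def MainData.ofCoframe (hι : IsComplexification (F := F) (E := E) ι) {ρ : P → K → P}
    {θ : P → V →L[ℝ] E} (hθ : IsEquivariantCoframe (F := F) ι ρ θ) :
    MainData (F := F) (E := V) ρ where
  principal := hθ.principal
  conn p := (ContinuousLinearMap.fst ℝ F F).comp ((reIm hι).toContinuousLinearMap.comp (θ p))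
  conn_ad :=
    { smooth := ((ContinuousLinearMap.fst ℝ F F).comp
        (reIm hι).toContinuousLinearMap).contMDiff.comp hθ.smooth
      equivariant := fun p k v => congrArg Prod.fst (hθ.reIm_apply hι p k v) }
  conn_fundamental p X := by
    have h := congrArg Prod.fst ((congrArg (reIm hι) (hθ.fundamental p X)).trans
      (reIm_modelDeriv hι X))
    exact h
  form p := -((ContinuousLinearMap.snd ℝ F F).comp ((reIm hι).toContinuousLinearMap.comp (θ p)))
  form_ad :=
    { smooth := (-((ContinuousLinearMap.snd ℝ F F).comp
        (reIm hι).toContinuousLinearMap)).contMDiff.comp hθ.smooth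
      equivariant := fun p k v =>
        (congrArg (fun z : F × F => -z.2) (hθ.reIm_apply hι p k v)).trans
          (map_neg (modelAd F k⁻¹) _).symm }
  form_fundamental p X := by
    have h := congrArg Prod.snd ((congrArg (reIm hι) (hθ.fundamental p X)).trans
      (reIm_modelDeriv hι X))
    exact (congrArg Neg.neg h).trans neg_zero
  form_bijective p := by
    constructor
    · rintro ⟨v, hv⟩ ⟨w, hw⟩ h
      have hv' : (reIm hι (θ p v)).1 = 0 := hv
      have hw' : (reIm hι (θ p w)).1 = 0 := hw
      have h' : -(reIm hι (θ p v)).2 = -(reIm hι (θ p w)).2 := h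
      refine Subtype.ext ((hθ.bijective p).1 ((reIm hι).injective ?_))
      exact Prod.ext (hv'.trans hw'.symm) (neg_injective h')
    · intro Y
      -- The vector with coframe value `-iY` is horizontal and has tensorial value `Y`.
      obtain ⟨v, hv⟩ := (hθ.bijective p).2 (ofReIm ι (0, -(show F from Y)))
      refine ⟨⟨v, ?_⟩, ?_⟩
      · change (reIm hι (θ p v)).1 = 0
        rw [hv, reIm_ofReIm]
      · change -(reIm hι (θ p v)).2 = Y
        rw [hv, reIm_ofReIm]
        exact neg_neg (show F from Y)

/-- An equivariant coframe is complex linear for the almost complex structure that it defines. -/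
theorem MainData.coframe_J (hι : IsComplexification (F := F) (E := E) ι) {ρ : P → K → P}
    {θ : P → V →L[ℝ] E} (hθ : IsEquivariantCoframe (F := F) ι ρ θ) (p : P) (v : V) :
    θ p ((MainData.ofCoframe hι hθ).J p v) = Complex.I • θ p v := by
  -- With `θ v = X + iY`, the vector `h` with `θ h = -iX` is the horizontal preimage of `X` under
  -- the tensorial form. So `J v = (-Y)^# - h`, with coframe value `-Y + iX`.
  obtain ⟨h, hh⟩ := (hθ.bijective p).2 (ofReIm ι (0, -(reIm hι (θ p v)).1))
  have h1 : (MainData.ofCoframe hι hθ).J p v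
      = modelDeriv F V (ρ p) 1 (-(reIm hι (θ p v)).2) - h := by
    refine MainData.J_apply _ p v h ?_ ?_
    · change (reIm hι (θ p h)).1 = 0
      rw [hh, reIm_ofReIm]
    · change -(reIm hι (θ p h)).2 = (reIm hι (θ p v)).1
      rw [hh, reIm_ofReIm, neg_neg]
  rw [h1, map_sub, hθ.fundamental, hh]
  conv_rhs => rw [← ofReIm_reIm hι (θ p v), smul_I_ofReIm]
  simp [ofReIm_apply]

end Coframe

/-! ### The Maurer–Cartan coframe on `G` and its descent to `Q`. -/

section Coframes

variable {F : Type*} [NormedAddCommGroup F] [NormedSpace ℝ F]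
  {K : Type*} [TopologicalSpace K] [ChartedSpace F K] [Group K] [LieGroup 𝓘(ℝ, F) ∞ K]
  [CompactSpace K]
  {E : Type*} [NormedAddCommGroup E] [NormedSpace ℂ E]
  {G : Type*} [TopologicalSpace G] [ChartedSpace E G] [Group G] [LieGroup 𝓘(ℂ, E) ω G]
  {ι : K →* G}

omit [LieGroup 𝓘(ℝ, F) ∞ K] in
/-- The Maurer–Cartan form is an equivariant coframe for the right translations by `K`. -/
theorem isEquivariantCoframe_maurerCartan (hι : IsComplexification (F := F) (E := E) ι) :
    IsEquivariantCoframe (F := F) ι (translationAction (K := K) (G := G) ι) (maurerCartan E) := by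
  have hG : LieGroup 𝓘(ℝ, E) ω G := LieGroup.restrictScalars_real E G
  refine ⟨⟨fun g => ?_, fun g k l => ?_, fun g k h => ?_, ?_⟩, contMDiff_maurerCartan,
    fun g k v => ?_, fun g X => ?_, fun g => ?_⟩
  · simp [translationAction]
  · simp [translationAction, mul_assoc]
  · exact hι.injective (by simpa [translationAction] using h)
  · exact ((contMDiff_mul 𝓘(ℝ, E) ω).of_le le_top).comp
      (contMDiff_fst.prodMk (hι.smooth.comp contMDiff_snd))
  · rw [map_inv]
    exact maurerCartan_mul_right g (ι k) v
  · have h := modelDeriv_comp (g := fun x : G => g * x) (f := ι) (1 : K)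
      (mdifferentiableAt_mul_left' (E := E) g (ι 1)) ((hι.smooth 1).mdifferentiableAt (by simp)) X
    rw [map_one] at h
    exact (congrArg (maurerCartan E g) h).trans (maurerCartan_leftTranslate g _)
  · exact Function.bijective_iff_has_inverse.2
      ⟨leftTranslate E g, leftTranslate_maurerCartan g, maurerCartan_leftTranslate g⟩

variable {E' : Type*} [NormedAddCommGroup E'] [NormedSpace ℂ E']
  {Q : Type*} [TopologicalSpace Q] [ChartedSpace E' Q] [IsManifold 𝓘(ℂ, E') ω Q]
  [MulAction Gᵐᵒᵖ Q]

omit [IsManifold 𝓘(ℂ, E') ω Q] in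
/-- The Maurer–Cartan form descends along the orbit map. -/
theorem exists_descended_maurerCartan [FiniteDimensional ℂ E]
    (hol : ContMDiff (𝓘(ℂ, E').prod 𝓘(ℂ, E)) 𝓘(ℂ, E') ω (fun x : Q × G => x.1 <• x.2)) (q₀ : Q)
    (hsurj : Function.Surjective (fun g : G => q₀ <• g))
    (hbij : ∀ g, Function.Bijective (modelDeriv E E' (fun h : G => q₀ <• h) g)) :
    ∃ θ : Q → E' →L[ℝ] E, ∀ (g : G) (v : E),
      θ (q₀ <• g) (modelDeriv E E' (fun h : G => q₀ <• h) g v) = maurerCartan E g v := by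
  have hG : LieGroup 𝓘(ℝ, E) ω G := LieGroup.restrictScalars_real E G
  have hψ : ContMDiff 𝓘(ℝ, E) 𝓘(ℝ, E') ω (fun h : G => q₀ <• h) :=
    (contMDiff_orbitMap hol q₀).restrictScalars_real rfl rfl
  choose σ hσ using hsurj
  let T : ∀ g : G, E ≃L[ℝ] E' := fun g =>
    (LinearEquiv.ofBijective (modelDeriv E E' (fun h : G => q₀ <• h) g).toLinearMap
      (hbij g)).toContinuousLinearEquiv
  refine ⟨fun q => (maurerCartan E (σ q)).comp (T (σ q)).symm.toContinuousLinearMap,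
    fun g v => ?_⟩
  -- The chosen preimage differs from `g` by left multiplication by an element `a` of the
  -- stabiliser; left invariance makes the choice irrelevant.
  obtain ⟨a, ha⟩ : ∃ a : G, a * g = σ (q₀ <• g) := ⟨σ (q₀ <• g) * g⁻¹, by simp⟩
  have haq : q₀ <• a = q₀ := by
    have h1 : q₀ <• (a * g) = q₀ <• g := by rw [ha]; exact hσ _
    rw [rightAct_mul] at h1
    simpa only [rightAct_mul_inv] using congrArg (fun q : Q => q <• g⁻¹) h1
  have h1 := modelDeriv_comp (g := fun h : G => q₀ <• h) (f := fun x : G => a * x) g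
    (mdifferentiableAt_of_contMDiff_omega hψ _) (mdifferentiableAt_mul_left' (E := E) a g) v
  simp only [rightAct_mul, haq] at h1
  have h2 : (T (σ (q₀ <• g))).symm (modelDeriv E E' (fun h : G => q₀ <• h) g v)
      = modelDeriv E E (fun x : G => a * x) g v := by
    rw [ContinuousLinearEquiv.symm_apply_eq, ← ha, h1]
    rfl
  change maurerCartan E (σ (q₀ <• g)) ((T (σ (q₀ <• g))).symm _) = _
  rw [h2, ← ha, maurerCartan_mul_left]

/-- The descended Maurer–Cartan form is smooth. -/
theorem contMDiff_descended_maurerCartan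
    {q₀ : Q} (hloc : IsLocalDiffeomorph 𝓘(ℂ, E) 𝓘(ℂ, E') ω (fun g : G => q₀ <• g))
    (hsurj : Function.Surjective (fun g : G => q₀ <• g))
    {θ : Q → E' →L[ℝ] E} (hθ : ∀ (g : G) (v : E),
      θ (q₀ <• g) (modelDeriv E E' (fun h : G => q₀ <• h) g v) = maurerCartan E g v) :
    ContMDiff 𝓘(ℝ, E').tangent 𝓘(ℝ, E) ∞
      (fun v : TangentBundle 𝓘(ℝ, E') Q => θ v.proj v.snd) := by
  have hG : LieGroup 𝓘(ℝ, E) ω G := LieGroup.restrictScalars_real E G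
  have hψ : ContMDiff 𝓘(ℝ, E) 𝓘(ℝ, E') ω (fun h : G => q₀ <• h) :=
    hloc.contMDiff.restrictScalars_real rfl rfl
  intro v
  obtain ⟨g, hg⟩ := hsurj v.proj
  obtain ⟨Φ, hgΦ, hΦ⟩ := hloc g
  have hO : IsOpen Φ.target := Φ.open_target
  have hvO : v.proj ∈ Φ.target := by
    rw [← hg, show (fun g : G => q₀ <• g) g = Φ g from hΦ hgΦ]
    exact Φ.map_source hgΦ
  have hs : ∀ q ∈ Φ.target, ContMDiffAt 𝓘(ℝ, E') 𝓘(ℝ, E) ω Φ.symm q := fun q hq =>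
    ((Φ.contMDiffOn_invFun q hq).contMDiffAt (hO.mem_nhds hq)).restrictScalars_real rfl rfl
  have hs' : ContMDiffOn 𝓘(ℝ, E') 𝓘(ℝ, E) ω Φ.symm Φ.target :=
    fun q hq => (hs q hq).contMDiffWithinAt
  have h1 := hs'.contMDiffOn_tangentMapWithin (m := ∞) le_top hO.uniqueMDiffOn
  have hpre : (Bundle.TotalSpace.proj ⁻¹' Φ.target : Set (TangentBundle 𝓘(ℝ, E') Q)) ∈ nhds v :=
    (hO.preimage (FiberBundle.continuous_proj E' (TangentSpace 𝓘(ℝ, E')))).mem_nhds hvO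
  -- Near `v` the descended form is the Maurer–Cartan form composed with the tangent map of the
  -- local inverse `Φ.symm`, as `h7` confirms.
  have h2 := contMDiff_maurerCartan.contMDiffAt.comp v ((h1 v hvO).contMDiffAt hpre)
  refine h2.congr_of_eventuallyEq (Filter.eventually_of_mem hpre fun w hw => ?_)
  have hw' : w.proj ∈ Φ.target := hw
  have h3 : q₀ <• Φ.symm w.proj = w.proj := by
    rw [show q₀ <• Φ.symm w.proj = Φ (Φ.symm w.proj) from hΦ (Φ.map_target hw')]
    exact Φ.right_inv hw'
  have h4 : ∀ u : E', modelDeriv E E' (fun h : G => q₀ <• h) (Φ.symm w.proj)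
      (modelDeriv E' E Φ.symm w.proj u) = u := by
    intro u
    rw [← modelDeriv_comp w.proj (mdifferentiableAt_of_contMDiff_omega hψ _)
      ((hs _ hw').mdifferentiableAt (by simp))]
    have h5 : (fun q => q₀ <• Φ.symm q) =ᶠ[nhds w.proj] fun q => q := by
      refine Filter.eventually_of_mem (hO.mem_nhds hw') fun q hq => ?_
      change q₀ <• Φ.symm q = q
      rw [show q₀ <• Φ.symm q = Φ (Φ.symm q) from hΦ (Φ.map_target hq)]
      exact Φ.right_inv hq
    have h6 : modelDeriv E' E' (fun q => q₀ <• Φ.symm q) w.proj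
        = modelDeriv E' E' (fun q : Q => q) w.proj := h5.mfderiv_eq
    rw [h6]
    exact modelDeriv_id _ _
  have h7 : ∀ u : E', θ w.proj u
      = maurerCartan E (Φ.symm w.proj) (modelDeriv E' E Φ.symm w.proj u) := by
    intro u
    have h := hθ (Φ.symm w.proj) (modelDeriv E' E Φ.symm w.proj u)
    rwa [h4, h3] at h
  refine (h7 w.snd).trans ?_
  have h8 := tangentMapWithin_eq_tangentMap (p := w) (hO.uniqueMDiffOn w.proj hw')
    ((hs w.proj hw').mdifferentiableAt (by simp))
  change _ = maurerCartan E (tangentMapWithin 𝓘(ℝ, E') 𝓘(ℝ, E) Φ.symm Φ.target w).proj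
    (tangentMapWithin 𝓘(ℝ, E') 𝓘(ℝ, E) Φ.symm Φ.target w).snd
  rw [h8]
  rfl

omit [LieGroup 𝓘(ℝ, F) ∞ K] in
/-- The descended Maurer–Cartan form is an equivariant coframe. -/
theorem isEquivariantCoframe_descended
    (hι : IsComplexification (F := F) (E := E) ι)
    (hol : ContMDiff (𝓘(ℂ, E').prod 𝓘(ℂ, E)) 𝓘(ℂ, E') ω (fun x : Q × G => x.1 <• x.2))
    (hfree : ∀ (q : Q) (k : K), q <• ι k = q → k = 1) {q₀ : Q}
    (hloc : IsLocalDiffeomorph 𝓘(ℂ, E) 𝓘(ℂ, E') ω (fun g : G => q₀ <• g))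
    (hsurj : Function.Surjective (fun g : G => q₀ <• g))
    (hbij : ∀ g, Function.Bijective (modelDeriv E E' (fun h : G => q₀ <• h) g))
    {θ : Q → E' →L[ℝ] E} (hθ : ∀ (g : G) (v : E),
      θ (q₀ <• g) (modelDeriv E E' (fun h : G => q₀ <• h) g v) = maurerCartan E g v) :
    IsEquivariantCoframe (F := F) ι (restrictedAction (K := K) (G := G) (Q := Q) ι) θ := by
  have hG : LieGroup 𝓘(ℝ, E) ω G := LieGroup.restrictScalars_real E G
  have hMC := isEquivariantCoframe_maurerCartan hι
  have hψ : ContMDiff 𝓘(ℝ, E) 𝓘(ℝ, E') ω (fun h : G => q₀ <• h) :=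
    hloc.contMDiff.restrictScalars_real rfl rfl
  have hR : ∀ g : G, ContMDiff 𝓘(ℝ, E') 𝓘(ℝ, E') ω (fun q : Q => q <• g) :=
    fun g => (contMDiff_rightAct hol g).restrictScalars_real rfl rfl
  have holR : ContMDiff (𝓘(ℝ, E').prod 𝓘(ℝ, E)) 𝓘(ℝ, E') ω (fun x : Q × G => x.1 <• x.2) :=
    hol.restrictScalars_real rfl rfl
  refine ⟨⟨fun q => ?_, fun q k l => ?_, fun q k h => hfree q k h, ?_⟩,
    contMDiff_descended_maurerCartan hloc hsurj hθ, fun q k w => ?_, fun q X => ?_, fun q => ?_⟩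
  · simp [restrictedAction]
  · simp only [restrictedAction, map_mul, rightAct_mul]
  · exact (holR.of_le le_top).comp (contMDiff_fst.prodMk (hι.smooth.comp contMDiff_snd))
  -- Every tangent vector of `Q` is the image of one on `G`, so equivariance is inherited from `G`
  -- through `q₀ (g k) = (q₀ g) k`.
  · obtain ⟨g, rfl⟩ := hsurj q
    obtain ⟨v, rfl⟩ := (hbij g).2 w
    have h1 := modelDeriv_comp (g := fun q : Q => q <• ι k) (f := fun h : G => q₀ <• h) g
      (mdifferentiableAt_of_contMDiff_omega (hR _) _)
      (mdifferentiableAt_of_contMDiff_omega hψ _) v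
    have h2 := modelDeriv_comp (g := fun h : G => q₀ <• h) (f := fun h : G => h * ι k) g
      (mdifferentiableAt_of_contMDiff_omega hψ _)
      (mdifferentiableAt_mul_right' (E := E) (ι k) g) v
    simp only [rightAct_mul] at h2
    rw [h1] at h2
    have h3 : restrictedAction (K := K) (Q := Q) ι (q₀ <• g) k = q₀ <• (g * ι k) :=
      (rightAct_mul q₀ g (ι k)).symm
    change θ (restrictedAction (K := K) (Q := Q) ι (q₀ <• g) k)
      (modelDeriv E' E' (fun q : Q => q <• ι k) (q₀ <• g)
        (modelDeriv E E' (fun h : G => q₀ <• h) g v)) = modelAd E (ι k⁻¹) (θ (q₀ <• g) _)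
    rw [h3, h2, hθ, hθ]
    exact hMC.equivariant g k v
  · obtain ⟨g, rfl⟩ := hsurj q
    have hd : MDifferentiableAt 𝓘(ℝ, F) 𝓘(ℝ, E) (fun k : K => g * ι k) 1 :=
      (mdifferentiableAt_mul_left' (E := E) g _).comp _
        ((hι.smooth 1).mdifferentiableAt (by simp))
    have h1 := modelDeriv_comp (g := fun h : G => q₀ <• h) (f := fun k : K => g * ι k) (1 : K)
      (mdifferentiableAt_of_contMDiff_omega hψ _) hd X
    simp only [rightAct_mul, map_one, mul_one] at h1
    exact (congrArg (θ (q₀ <• g)) h1).trans ((hθ _ _).trans (hMC.fundamental g X))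
  · obtain ⟨g, rfl⟩ := hsurj q
    have h : θ (q₀ <• g) ∘ modelDeriv E E' (fun h : G => q₀ <• h) g = maurerCartan E g :=
      funext (hθ g)
    rw [← Function.Bijective.of_comp_iff _ (hbij g), h]
    exact hMC.bijective g

end Coframes

/-! ### Uniqueness of the sample and descended data, and the comparison of complex structures. -/

section Sample

variable {F : Type*} [NormedAddCommGroup F] [NormedSpace ℝ F] [FiniteDimensional ℝ F]
  {K : Type*} [TopologicalSpace K] [ChartedSpace F K] [Group K] [LieGroup 𝓘(ℝ, F) ∞ K]
  [CompactSpace K]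
  {E : Type*} [NormedAddCommGroup E] [NormedSpace ℂ E]
  {G : Type*} [TopologicalSpace G] [ChartedSpace E G] [Group G] [LieGroup 𝓘(ℂ, E) ω G]
  {ι : K →* G}

/-- The sample data are the components of the Maurer–Cartan form. -/
theorem isSample_iff (hι : IsComplexification (F := F) (E := E) ι)
    (S : MainData (F := F) (E := E) (translationAction (K := K) (G := G) ι)) :
    IsSample ι S ↔ S = MainData.ofCoframe hι (isEquivariantCoframe_maurerCartan hι) := by
  have hG : LieGroup 𝓘(ℝ, E) ω G := LieGroup.restrictScalars_real E G
  constructor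
  · intro h
    -- Every tangent vector at `g` is the value of some left-invariant field `(X + iY)^#`, so the
    -- sample conditions determine both forms.
    have key : ∀ (g : G) (v : E),
        leftTranslate E g (ofReIm ι (reIm hι (maurerCartan E g v))) = v := fun g v => by
      rw [ofReIm_reIm, leftTranslate_maurerCartan]
    have hs : ∀ (g : G) (z : F × F), S.form g (leftTranslate E g (ofReIm ι z)) = (-z.2 : F) ∧
        S.conn g (leftTranslate E g (ofReIm ι z)) = z.1 := fun g z => by
      rw [ofReIm_apply]
      exact h g z.1 z.2
    refine MainData.ext_of_conn_form ?_ ?_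
    · refine funext fun g => ContinuousLinearMap.ext fun v => ?_
      exact (congrArg (S.conn g) (key g v)).symm.trans (hs g (reIm hι (maurerCartan E g v))).2
    · refine funext fun g => ContinuousLinearMap.ext fun v => ?_
      exact (congrArg (S.form g) (key g v)).symm.trans (hs g (reIm hι (maurerCartan E g v))).1
  · rintro rfl g X Y
    have h1 : ∀ X Y : F, reIm hι (maurerCartan E g (leftTranslate E g
        (modelDeriv F E ι 1 X + Complex.I • modelDeriv F E ι 1 Y))) = (X, Y) := fun X Y => by
      rw [← ofReIm_apply ι (X, Y), maurerCartan_leftTranslate, reIm_ofReIm]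
    exact ⟨congrArg (fun z : F × F => -z.2) (h1 X Y), congrArg Prod.fst (h1 X Y)⟩

variable {E' : Type*} [NormedAddCommGroup E'] [NormedSpace ℂ E']
  {Q : Type*} [TopologicalSpace Q] [ChartedSpace E' Q] [IsManifold 𝓘(ℂ, E') ω Q]
  [MulAction Gᵐᵒᵖ Q]

/-- The data which descend from the sample data are the components of the descended
Maurer–Cartan form. -/
theorem descendsTo_iff (hι : IsComplexification (F := F) (E := E) ι) {q₀ : Q}
    (hsurj : Function.Surjective (fun g : G => q₀ <• g))
    (hbij : ∀ g, Function.Bijective (modelDeriv E E' (fun h : G => q₀ <• h) g))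
    {θ : Q → E' →L[ℝ] E} (hθ : ∀ (g : G) (v : E),
      θ (q₀ <• g) (modelDeriv E E' (fun h : G => q₀ <• h) g v) = maurerCartan E g v)
    (hc : IsEquivariantCoframe (F := F) ι (restrictedAction (K := K) (G := G) (Q := Q) ι) θ)
    (D : MainData (F := F) (E := E') (restrictedAction (K := K) (G := G) (Q := Q) ι)) :
    DescendsTo ι q₀ (MainData.ofCoframe hι (isEquivariantCoframe_maurerCartan hι)) D ↔
      D = MainData.ofCoframe hι hc := by
  constructor
  · intro h
    refine MainData.ext_of_conn_form ?_ ?_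
    · refine funext fun q => ContinuousLinearMap.ext fun w => ?_
      obtain ⟨g, rfl⟩ := hsurj q
      obtain ⟨v, rfl⟩ := (hbij g).2 w
      exact (h g v).2.trans (congrArg (fun u : E => (reIm hι u).1) (hθ g v)).symm
    · refine funext fun q => ContinuousLinearMap.ext fun w => ?_
      obtain ⟨g, rfl⟩ := hsurj q
      obtain ⟨v, rfl⟩ := (hbij g).2 w
      exact (h g v).1.trans (congrArg (fun u : E => -(reIm hι u).2) (hθ g v)).symm
  · rintro rfl g v
    exact ⟨congrArg (fun u : E => -(reIm hι u).2) (hθ g v),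
      congrArg (fun u : E => (reIm hι u).1) (hθ g v)⟩

omit [IsManifold 𝓘(ℂ, E') ω Q] in
/-- The descended Maurer–Cartan form is complex linear. -/
theorem descended_maurerCartan_smul_I
    (hol : ContMDiff (𝓘(ℂ, E').prod 𝓘(ℂ, E)) 𝓘(ℂ, E') ω (fun x : Q × G => x.1 <• x.2)) {q₀ : Q}
    (hsurj : Function.Surjective (fun g : G => q₀ <• g))
    (hbij : ∀ g, Function.Bijective (modelDeriv E E' (fun h : G => q₀ <• h) g))
    {θ : Q → E' →L[ℝ] E} (hθ : ∀ (g : G) (v : E),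
      θ (q₀ <• g) (modelDeriv E E' (fun h : G => q₀ <• h) g v) = maurerCartan E g v)
    (q : Q) (w : E') : θ q (Complex.I • w) = Complex.I • θ q w := by
  obtain ⟨g, rfl⟩ := hsurj q
  obtain ⟨v, rfl⟩ := (hbij g).2 w
  have hl : ContMDiff 𝓘(ℂ, E) 𝓘(ℂ, E) ω (fun x : G => g⁻¹ * x) := contMDiff_mul_left
  have h1 := modelDeriv_smul_I ((contMDiff_orbitMap hol q₀ g).mdifferentiableAt (by simp)) v
  have h2 := modelDeriv_smul_I ((hl g).mdifferentiableAt (by simp)) v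
  change θ (q₀ <• g) _ = Complex.I • θ (q₀ <• g) _
  rw [← h1, hθ, hθ]
  exact h2

end Sample

theorem proposition4p1
    {F : Type*} [NormedAddCommGroup F] [NormedSpace ℝ F] [FiniteDimensional ℝ F]
    {K : Type*} [TopologicalSpace K] [ChartedSpace F K] [Group K] [LieGroup 𝓘(ℝ, F) ∞ K]
    [CompactSpace K]
    {E : Type*} [NormedAddCommGroup E] [NormedSpace ℂ E] [FiniteDimensional ℂ E]
    {G : Type*} [TopologicalSpace G] [ChartedSpace E G] [Group G] [LieGroup 𝓘(ℂ, E) ω G]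
    (ι : K →* G) (hι : IsComplexification (F := F) (E := E) ι)
    {E' : Type*} [NormedAddCommGroup E'] [NormedSpace ℂ E'] [FiniteDimensional ℂ E']
    {Q : Type*} [TopologicalSpace Q] [ChartedSpace E' Q] [IsManifold 𝓘(ℂ, E') ω Q]
    [T2Space Q] [ConnectedSpace Q]
    [MulAction Gᵐᵒᵖ Q]
    (hol : ContMDiff (𝓘(ℂ, E').prod 𝓘(ℂ, E)) 𝓘(ℂ, E') ω (fun x : Q × G => x.1 <• x.2))
    (htrans : MulAction.IsPretransitive Gᵐᵒᵖ Q)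
    (q₀ : Q) (hdisc : DiscreteTopology {g : G | q₀ <• g = q₀})
    (hfree : ∀ (q : Q) (k : K), q <• ι k = q → k = 1) :
    -- the orbit map is a surjective local biholomorphism, which identifies `Γ \ G` with `Q`
    (IsLocalDiffeomorph 𝓘(ℂ, E) 𝓘(ℂ, E') ω (fun g : G => q₀ <• g) ∧
      Function.Surjective (fun g : G => q₀ <• g)) ∧
    -- the sample data exist on `G → G / K`, and they are unique
    (∃! S : MainData (F := F) (E := E) (translationAction (K := K) (G := G) ι), IsSample ι S) ∧
    ∀ S : MainData (F := F) (E := E) (translationAction (K := K) (G := G) ι), IsSample ι S →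
      -- they descend to unique data on `Q → Q / K`
      (∃! D : MainData (F := F) (E := E') (restrictedAction (K := K) (G := G) (Q := Q) ι),
        DescendsTo ι q₀ S D) ∧
      -- whose almost complex structure is the canonical one
      ∀ D : MainData (F := F) (E := E') (restrictedAction (K := K) (G := G) (Q := Q) ι),
        DescendsTo ι q₀ S D → ∀ q : Q, D.J q = canonicalJ E' Q q := by
  have hfin : Finite (ConnectedComponents G) := hι.finite_components
  have hloc := isLocalDiffeomorph_orbitMap hol hdisc
  have hsurj := orbitMap_surjective (G := G) q₀
  have hbij := modelDeriv_orbitMap_bijective hol hdisc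
  obtain ⟨θ, hθ⟩ := exists_descended_maurerCartan hol q₀ hsurj hbij
  have hc := isEquivariantCoframe_descended hι hol hfree hloc hsurj hbij hθ
  refine ⟨⟨hloc, hsurj⟩, ⟨_, (isSample_iff hι _).2 rfl, fun S hS => (isSample_iff hι S).1 hS⟩,
    fun S hS => ?_⟩
  obtain rfl := (isSample_iff hι S).1 hS
  refine ⟨⟨_, (descendsTo_iff hι hsurj hbij hθ hc _).2 rfl,
    fun D hD => (descendsTo_iff hι hsurj hbij hθ hc D).1 hD⟩, fun D hD q => ?_⟩
  obtain rfl := (descendsTo_iff hι hsurj hbij hθ hc D).1 hD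
  -- It suffices to compare after the injective map `θ q`, which turns both structures into
  -- multiplication by `i`.
  refine LinearMap.ext fun w => (hc.bijective q).1 ?_
  exact (MainData.coframe_J hι hc q w).trans
    (descended_maurerCartan_smul_I hol hsurj hbij hθ q w).symm
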